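/- Let $I$ and $J$ be disjoint index sets and let $C=(c_{k,m})_{k,m\in I\sqcup J}$ be a positive definite matrix with real entries, where "positive definite" means symmetric and positive semidefinite (possibly singular), i.e. $\sum_{k,m}x_kx_mc_{k,m}\ge 0$ for all finitely supported real $x$. *Bi-free central limit distributions.* For $\chi:\{1,\dots,n\}\to I\sqcup J$, call position $t$ left if $\chi(t)\in I$ and right if $\chi(t)\in J$, and let $\prec_\chi$ be the total order on $\{1,\dots,n\}$ that lists first the left positions increasingly and then the right positions decreasingly. Let $BNC(n,\chi)$ be the set of partitions of $\{1,\dots,n\}$ that are non-crossing for $\prec_\chi$. For elements $(a_k)_{k\in I\sqcup J}$ of a unital algebra with a linear functional $\varphi$, the bi-free cumulants $\kappa_\chi(a_{\chi(1)},\dots,a_{\chi(n)})$ are determined recursively by $$\varphi(a_{\chi(1)}\cdots a_{\chi(n)})=\sum_{\pi\in BNC(n,\chi)}\prod_{V\in\pi}\kappa_{\chi|_V}\big((a_{\chi(t)})_{t\in V}\big),\qquad n\ge 1 .$$ The two-faced family $((a_i)_{i\in I},(a_j)_{j\in J})$ has a (centered) bi-free central limit distribution with covariance matrix $C$ if all its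 bi-free cumulants of order $1$ and of order at least $3$ vanish and $\varphi(a_ka_m)=c_{k,m}$ for all $k,m\in I\sqcup J$. *Random two-faced families.* For a probability space $(\Omega,P)$ let $L^{\infty-}=\bigcap_{1\le p<\infty}L^p(\Omega,P)$ (complex valued), with $E(f)=\int f\,dP$, acting on itself by multiplication. On $\mathcal X_N=M_N(L^{\infty-})$, a matrix $T=[T_{l,m}]$ with entries in $L^{\infty-}$ defines the left operator $L(T)[\eta_{l,m}]=[\sum_r T_{l,r}\eta_{r,m}]$ and the right operator $R(T)[\eta_{l,m}]=[\sum_r T_{r,m}\eta_{l,r}]$. For a linear operator $B$ on $\mathcal X_N$, $E_{\mathcal L(\mathcal X_N)}(B)\in M_N(\mathbb C)$ is obtained by applying $E$ to each entry of $B(\mathrm{diag}(1,\dots,1))$. For each $N\ge 1$ let $[X^k_{i,j;N}]_{i,j=1}^N$, $k\in I\sqcup J$, be matrices with entries in $L^{\infty-}(\Omega_N,P_N)$ for a probability space $(\Omega_N,P_N)$ (which may depend on $N$). Put $X^k_N=L([X^k_{i,j;N}])$ for $k\in I$ and $X^k_N=R([X^k_{i,j;N}])$ for $k\in J$. These form self-adjoint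 $C$-random two-faced families if 1. $E(X^k_{i,j;N})=0$ for all $i,j,k,N$; 2. $X^k_{j,i;N}=\overline{X^k_{i,j;N}}$ for all $i,j,k,N$; 3. for each $N$, the sets of random variables $\{X^k_{i,j;N}:k\in I\sqcup J\}$, $1\le i\le j\le N$, are independent; 4. $E(X^{k_1}_{i,j;N}X^{k_2}_{j,i;N})=\frac1N c_{k_1,k_2}$ for all $i,j,k_1,k_2,N$; 5. for every $m\in\mathbb N$ and $\chi:\{1,\dots,m\}\to I\sqcup J$ there are $M(\chi,m)>0$ and $N_0\in\mathbb N$ such that, for all $N>N_0$, all $1\le i\le j\le N$ and all choices of $(\lambda(l),\tau(l))\in\{(i,j),(j,i)\}$, $l=1,\dots,m$, $$\big|E\big(X^{\chi(1)}_{\lambda(1),\tau(1);N}\cdots X^{\chi(m)}_{\lambda(m),\tau(m);N}\big)\big|\le M(\chi,m)\,N^{-m/2}.$$ **Theorem.** Let $((a_i)_{i\in I},(a_j)_{j\in J})$ be a two-faced family of self-adjoint random variables in a $*$-probability space $(\mathcal A,\varphi)$ (a unital $*$-algebra with a unital positive linear functional) having a bi-free central limit distribution with covariance matrix $C$, and for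 each $N$ let $((X^i_N)_{i\in I},(X^j_N)_{j\in J})$ be as above, self-adjoint $C$-random two-faced families of $N\times N$ matrices. Then for every $n\in\mathbb N$ and every $\chi:\{1,\dots,n\}\to I\sqcup J$, $$\lim_{N\to\infty}\frac1N\mathrm{Tr}\Big(E_{\mathcal L(\mathcal X_N)}\big(X^{\chi(1)}_N X^{\chi(2)}_N\cdots X^{\chi(n)}_N\big)\Big)=\varphi\big(a_{\chi(1)}a_{\chi(2)}\cdots a_{\chi(n)}\big).$$ -/

import Mathlib

open MeasureTheory ProbabilityTheory Filter Topology
open scoped ENNReal ComplexOrder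

noncomputable section

namespace BiFree

/-! ### Bi-non-crossing partitions and bi-free cumulants -/

/-- The two faces: left and right. -/
inductive Side
  | left
  | right

/-- Elements of the first index set are left, elements of the second one are right. -/
def sideOf {I J : Type*} : I ⊕ J → Side
  | Sum.inl _ => Side.left
  | Sum.inr _ => Side.right

/-- The total order on positions attached to `χ`: first the left positions in increasing order,
then the right positions in decreasing order. In other words, if `s_χ` is the permutation listing
the left positions increasingly and then the right positions decreasingly, then `chiLT χ x y`
means `s_χ⁻¹ x < s_χ⁻¹ y`. -/
def chiLT {n : ℕ} (χ : Fin n → Side) (x y : Fin n) : Prop :=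
  match χ x, χ y with
  | Side.left, Side.left => x < y
  | Side.left, Side.right => True
  | Side.right, Side.left => False
  | Side.right, Side.right => y < x

/-- A partition of the positions is bi-non-crossing for `χ` if it is the image under `s_χ` of a
non-crossing partition, that is, if no two distinct blocks cross for the order `chiLT χ`. -/
def IsBiNonCrossing {n : ℕ} (χ : Fin n → Side)
    (π : Finpartition (Finset.univ : Finset (Fin n))) : Prop :=
  ∀ V ∈ π.parts, ∀ W ∈ π.parts, ∀ a ∈ V, ∀ b ∈ W, ∀ c ∈ V, ∀ d ∈ W,
    chiLT χ a b → chiLT χ b c → chiLT χ c d → V = W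

open Classical in
/-- The finite set `BNC(n, χ)`. -/
def bnc {n : ℕ} (χ : Fin n → Side) : Finset (Finpartition (Finset.univ : Finset (Fin n))) :=
  Finset.univ.filter (IsBiNonCrossing χ)

open Classical in
/-- The bi-free cumulants `κ_χ(a_1, …, a_n)`, determined recursively by the bi-free
moment-cumulant relation `φ(a_1 ⋯ a_n) = ∑_{π ∈ BNC(n, χ)} ∏_{V ∈ π} κ_{χ|V}((a_1, …, a_n)|V)`:
the term of the one-block partition is isolated. Here `χ|V` and `(a_1, …, a_n)|V` are the
restrictions to the increasing enumeration of the block `V`. -/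
def bifreeCumulant {A : Type*} [Ring A] [Algebra ℂ A] (φ : A →ₗ[ℂ] ℂ) (n : ℕ)
    (χ : Fin n → Side) (a : Fin n → A) : ℂ :=
  φ (List.ofFn a).prod -
    ∑ π ∈ ((bnc χ).filter fun π => Finset.univ ∉ π.parts).attach,
      ∏ V ∈ π.1.parts.attach,
        bifreeCumulant φ V.1.card (χ ∘ V.1.orderEmbOfFin rfl) (a ∘ V.1.orderEmbOfFin rfl)
termination_by n
decreasing_by
  have h1 : V.1 ≠ Finset.univ := fun h =>
    (Finset.mem_filter.1 π.2).2 (by have h3 := V.2; rwa [h] at h3)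
  have h2 := (Finset.card_lt_iff_ne_univ V.1).2 h1
  simpa using h2

/-- The bi-free moment-cumulant relation, which determines the bi-free cumulants. -/
theorem moment_eq_sum_bifreeCumulant {A : Type*} [Ring A] [Algebra ℂ A] (φ : A →ₗ[ℂ] ℂ) {n : ℕ}
    (hn : 1 ≤ n) (χ : Fin n → Side) (a : Fin n → A) :
    φ (List.ofFn a).prod = ∑ π ∈ bnc χ, ∏ V ∈ π.parts,
      bifreeCumulant φ V.card (χ ∘ V.orderEmbOfFin rfl) (a ∘ V.orderEmbOfFin rfl) := by
  classical
  have hne : (Finset.univ : Finset (Fin n)) ≠ ⊥ := by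
    have : Nonempty (Fin n) := ⟨⟨0, hn⟩⟩
    exact Finset.univ_nonempty.ne_empty
  have htop : ∀ π : Finpartition (Finset.univ : Finset (Fin n)),
      Finset.univ ∈ π.parts ↔ π = Finpartition.indiscrete hne := by
    intro π
    constructor
    · intro h
      ext V
      simp only [Finpartition.indiscrete_parts, Finset.mem_singleton]
      refine ⟨fun hV => ?_, fun hV => hV ▸ h⟩
      by_contra hVne
      have := π.disjoint hV h hVne
      exact π.ne_bot hV (by
        have h1 : Disjoint V Finset.univ := this
        exact disjoint_top.1 h1)
    · rintro rfl; simp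
  have hmem : Finpartition.indiscrete hne ∈ (bnc χ).filter fun π => Finset.univ ∈ π.parts := by
    simp only [Finset.mem_filter, bnc, Finset.mem_univ, true_and, Finpartition.indiscrete_parts,
      Finset.mem_singleton, and_true]
    intro V hV W hW
    simp_all
  have hfil : ((bnc χ).filter fun π => Finset.univ ∈ π.parts) = {Finpartition.indiscrete hne} := by
    ext π
    simp only [Finset.mem_singleton]
    refine ⟨fun h => (htop π).1 (Finset.mem_filter.1 h).2, fun h => h ▸ hmem⟩
  rw [← Finset.sum_filter_add_sum_filter_not (bnc χ) (fun π => Finset.univ ∈ π.parts), hfil,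
    Finset.sum_singleton, Finpartition.indiscrete_parts, Finset.prod_singleton]
  have hcard : ∀ (m : ℕ) (h : (Finset.univ : Finset (Fin n)).card = m) (hm : m = n),
      bifreeCumulant φ m (χ ∘ Finset.univ.orderEmbOfFin h) (a ∘ Finset.univ.orderEmbOfFin h)
        = bifreeCumulant φ n χ a := by
    rintro m h rfl
    have : (Finset.univ.orderEmbOfFin h : Fin m → Fin m) = id :=
      (Finset.orderEmbOfFin_unique h (fun _ => Finset.mem_univ _) strictMono_id).symm
    rw [this]; rfl
  rw [hcard _ rfl (by simp)]
  rw [bifreeCumulant]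
  rw [← Finset.sum_attach ((bnc χ).filter fun π => Finset.univ ∉ π.parts)]
  simp_rw [Finset.prod_attach _ (fun V : Finset (Fin n) => bifreeCumulant φ V.card (χ ∘ V.orderEmbOfFin rfl) (a ∘ V.orderEmbOfFin rfl))]
  ring

/-- A two-faced family has a (centered) bi-free central limit distribution if all its bi-free
cumulants of order one and of order at least three vanish. -/
def HasBifreeCentralLimit {A : Type*} [Ring A] [Algebra ℂ A] (φ : A →ₗ[ℂ] ℂ)
    {I J : Type*} (a : I ⊕ J → A) : Prop :=
  ∀ (n : ℕ) (χ : Fin n → I ⊕ J), n = 1 ∨ 3 ≤ n →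
    bifreeCumulant φ n (fun t => sideOf (χ t)) (fun t => a (χ t)) = 0

/-- `(A, φ)` is a `*`-probability space: `φ` is a unital positive linear functional on the unital
`*`-algebra `A`. -/
structure IsStarProbabilitySpace {A : Type*} [Ring A] [StarRing A] [Algebra ℂ A]
    (φ : A →ₗ[ℂ] ℂ) : Prop where
  map_one : φ 1 = 1
  nonneg : ∀ x : A, 0 ≤ φ (star x * x)

/-! ### Matrices of operators on a pointed vector space -/

section BiMatrix

variable {X : Type*} [AddCommMonoid X] [Module ℂ X] {N : ℕ}

/-- `L([T_{ij}])[η_{ij}] = [∑_k T_{ik} η_{kj}]`. -/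
def leftMat (T : Matrix (Fin N) (Fin N) (Module.End ℂ X)) :
    Module.End ℂ (Matrix (Fin N) (Fin N) X) where
  toFun η := Matrix.of fun i j => ∑ k, T i k (η k j)
  map_add' η ζ := by ext i j; simp [Finset.sum_add_distrib]
  map_smul' c η := by ext i j; simp [Finset.smul_sum]

/-- `R([T_{ij}])[η_{ij}] = [∑_k T_{kj} η_{ik}]`. -/
def rightMat (T : Matrix (Fin N) (Fin N) (Module.End ℂ X)) :
    Module.End ℂ (Matrix (Fin N) (Fin N) X) where
  toFun η := Matrix.of fun i j => ∑ k, T k j (η i k)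
  map_add' η ζ := by ext i j; simp [Finset.sum_add_distrib]
  map_smul' c η := by ext i j; simp [Finset.smul_sum]

/-- The expectation `A ↦ p_N (A diag(ξ, …, ξ))` of the operators on `M_N(X)` onto `M_N(ℂ)`, where
`p_N` applies `p` to every entry. -/
def matExpectation (ξ : X) (p : X →ₗ[ℂ] ℂ) (A : Module.End ℂ (Matrix (Fin N) (Fin N) X)) :
    Matrix (Fin N) (Fin N) ℂ :=
  (A (Matrix.diagonal fun _ => ξ)).map p

end BiMatrix

/-! ### Random variables with moments of all orders -/

section LInf

variable {Ω : Type*} [MeasurableSpace Ω]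

/-- `L^{∞-}(Ω, P) = ⋂_{1 ≤ p < ∞} L^p(Ω, P)`, complex random variables up to a.e. equality. -/
def LInfMinus (P : Measure Ω) : Submodule ℂ (Ω →ₘ[P] ℂ) where
  carrier := {f | ∀ p : ℝ≥0∞, 1 ≤ p → p ≠ ∞ → MemLp f p P}
  add_mem' {f g} hf hg p h1 hp :=
    (memLp_congr_ae (AEEqFun.coeFn_add f g)).2 ((hf p h1 hp).add (hg p h1 hp))
  zero_mem' _ _ _ := (memLp_congr_ae AEEqFun.coeFn_zero).2 MemLp.zero
  smul_mem' c f hf p h1 hp :=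
    (memLp_congr_ae (AEEqFun.coeFn_smul c f)).2 ((hf p h1 hp).const_smul c)

theorem mul_mem_LInfMinus {P : Measure Ω} {f g : Ω →ₘ[P] ℂ}
    (hf : f ∈ LInfMinus P) (hg : g ∈ LInfMinus P) : f * g ∈ LInfMinus P := by
  intro p h1 hp
  have h2 : (1 : ℝ≥0∞) ≤ 2 * p := h1.trans (le_mul_of_one_le_left (zero_le) one_le_two)
  have h3 : 2 * p ≠ ∞ := ENNReal.mul_ne_top ENNReal.ofNat_ne_top hp
  have : ENNReal.HolderTriple (2 * p) (2 * p) p := ⟨by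
    rw [ENNReal.mul_inv (by simp) (by simp), ← add_mul, ENNReal.inv_two_add_inv_two, one_mul]⟩
  exact (memLp_congr_ae (AEEqFun.coeFn_mul f g)).2 ((hg _ h2 h3).mul (hf _ h2 h3))

/-- The constant random variable `1`. -/
def unitRV (P : Measure Ω) [IsProbabilityMeasure P] : LInfMinus P :=
  ⟨1, fun _ _ _ => (memLp_congr_ae AEEqFun.coeFn_one).2 (memLp_const 1)⟩

/-- A random variable acting on `L^{∞-}` by multiplication; this is the inclusion of `L^{∞-}` into
the linear operators on `L^{∞-}`. -/
def mulOp {P : Measure Ω} (f : LInfMinus P) : Module.End ℂ (LInfMinus P) where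
  toFun g := ⟨f.1 * g.1, mul_mem_LInfMinus f.2 g.2⟩
  map_add' g h := by
    refine Subtype.ext (AEEqFun.ext ?_)
    filter_upwards [AEEqFun.coeFn_mul f.1 (g + h).1, AEEqFun.coeFn_add g.1 h.1,
      AEEqFun.coeFn_mul f.1 g.1, AEEqFun.coeFn_mul f.1 h.1,
      AEEqFun.coeFn_add (f.1 * g.1) (f.1 * h.1)] with ω h1 h2 h3 h4 h5
    simp only [Submodule.coe_add, Pi.mul_apply, Pi.add_apply] at *
    rw [h1, h2, h5, h3, h4, mul_add]
  map_smul' c g := by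
    refine Subtype.ext (AEEqFun.ext ?_)
    filter_upwards [AEEqFun.coeFn_mul f.1 (c • g).1, AEEqFun.coeFn_smul c g.1,
      AEEqFun.coeFn_mul f.1 g.1, AEEqFun.coeFn_smul c (f.1 * g.1)] with ω h1 h2 h3 h4
    simp only [Submodule.coe_smul, Pi.mul_apply, Pi.smul_apply, smul_eq_mul,
      RingHom.id_apply] at *
    rw [h1, h2, h4, h3, mul_left_comm]

theorem integrable_LInfMinus {P : Measure Ω} (f : LInfMinus P) : Integrable f.1 P :=
  memLp_one_iff_integrable.1 (f.2 1 le_rfl ENNReal.one_ne_top)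

/-- The expectation `E(f) = ∫ f dP` on `L^{∞-}(Ω, P)`. -/
def expect (P : Measure Ω) : LInfMinus P →ₗ[ℂ] ℂ where
  toFun f := ∫ ω, f.1 ω ∂P
  map_add' f g := by
    rw [← integral_add (integrable_LInfMinus f) (integrable_LInfMinus g)]
    exact integral_congr_ae (AEEqFun.coeFn_add f.1 g.1)
  map_smul' c f := by
    rw [RingHom.id_apply, ← integral_smul]
    exact integral_congr_ae (AEEqFun.coeFn_smul c f.1)

/-- The two-faced family of operators attached to matrices of random variables: left matrices for
indices in `I`, right matrices for indices in `J`. -/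
def faceOp {P : Measure Ω} {I J : Type*} {N : ℕ}
    (X : I ⊕ J → Matrix (Fin N) (Fin N) (LInfMinus P)) :
    I ⊕ J → Module.End ℂ (Matrix (Fin N) (Fin N) (LInfMinus P))
  | Sum.inl i => leftMat ((X (Sum.inl i)).map mulOp)
  | Sum.inr j => rightMat ((X (Sum.inr j)).map mulOp)

end LInf

/-- The matrices `X N k`, `k ∈ I ⊔ J`, are the entries of self-adjoint `C`-random two-faced families
of `N × N` matrices, `N = 1, 2, …`. The probability space may depend on `N`; the constants `M` and
`N₀` in the moment bound depend only on the word `χ`. -/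
structure IsRandomTwoFaced {I J : Type*} (C : Matrix (I ⊕ J) (I ⊕ J) ℝ)
    {Ω : ℕ → Type*} [∀ N, MeasurableSpace (Ω N)] (P : ∀ N, Measure (Ω N))
    (X : ∀ N : ℕ, I ⊕ J → Matrix (Fin N) (Fin N) (LInfMinus (P N))) : Prop where
  centered : ∀ N k i j, ∫ ω, (X N k i j).1 ω ∂(P N) = 0
  selfAdjoint : ∀ N k i j, (X N k j i).1 = star (X N k i j).1
  indep : ∀ N, iIndepFun
    (fun (q : {q : Fin N × Fin N // q.1 ≤ q.2}) (ω : Ω N) (k : I ⊕ J) =>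
      (X N k q.1.1 q.1.2).1 ω) (P N)
  covariance : ∀ N k₁ k₂ i j,
    ∫ ω, (X N k₁ i j).1 ω * (X N k₂ j i).1 ω ∂(P N) = (C k₁ k₂ : ℂ) / (N : ℂ)
  moment_bound : ∀ (m : ℕ) (χ : Fin m → I ⊕ J), ∃ M : ℝ, 0 < M ∧ ∃ N₀ : ℕ, ∀ N, N₀ < N →
    ∀ i j : Fin N, i ≤ j → ∀ lam : Fin m → Fin N × Fin N,
      (∀ l, lam l = (i, j) ∨ lam l = (j, i)) →
      ‖∫ ω, ∏ l, (X N (χ l) (lam l).1 (lam l).2).1 ω ∂(P N)‖ ≤ M * (N : ℝ) ^ (-(m : ℝ) / 2)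

end BiFree

end

/-! The proof is Wigner's moment method. Left operators multiply on the left and right operators on
the right, so applied to the identity matrix the word becomes, for almost every sample point, an
ordinary product of matrices: the left ones in increasing order of position, then the right ones in
decreasing order, which is the order defining bi-non-crossing partitions
(`evalMat_prod_faceOp_diagonal`). The expected trace is therefore a sum over closed walks of length
`n` on `N` vertices (`trace_matExpectation`).

By independence the weight of a walk factors over its unoriented edges
(`integral_prod_eq_prod_edges`). An edge traversed only once contributes a centered factor, so only
walks repeating every edge survive. Such a walk has at most `n / 2 + 1` vertices
(`card_image_le_of_edgesRepeat`), and its weight is of order `N ^ (-n / 2)`. After division by `N`,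
the walks with fewer vertices add up to at most a constant times `N ^ (-1 / 2)`
(`tendsto_sum_walkExpectation_zero`).

A walk with exactly `n / 2 + 1` vertices runs around a tree: every edge is used twice, in opposite
directions, and the pairing of steps obeys a last-in-first-out rule, hence does not cross
(`closes_innermost`, `exists_pairing_of_card_image_eq`). Its weight is a product of covariances
divided by `N ^ (n / 2)`. Conversely, each non-crossing pairing comes from one walk for every
injective labeling of the root and the `n / 2` pairs (`card_walks_of_pairing`). The limit is thus
the sum over bi-non-crossing pair partitions of products of covariances. This is the moment of the
limit family, because only its cumulants of order two survive and these are the covariances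
(`moment_eq_sum_bncPairs`). -/

namespace BiFree

/-! ### Walks whose edges are all traversed at least twice -/

section Walks

variable {α : Type*} {n : ℕ}

/-- The unoriented edge traversed by the `p`-th step of a walk. -/
def stepEdge (w : Fin (n + 1) → α) (p : Fin n) : Sym2 α := s(w p.castSucc, w p.succ)

/-- The `p`-th step leads to a vertex that has not been visited before. -/
def IsNewStep (w : Fin (n + 1) → α) (p : Fin n) : Prop :=
  ∀ r : Fin (n + 1), r ≤ p.castSucc → w r ≠ w p.succ

/-- After a step both endpoints of its edge have been visited, so a later step along the same edge
cannot end at a new vertex. -/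
theorem IsNewStep.eq_of_edge_eq {w : Fin (n + 1) → α} {p q : Fin n} (hp : IsNewStep w p)
    (hq : IsNewStep w q) (h : stepEdge w p = stepEdge w q) : p = q := by
  wlog hpq : p < q generalizing p q
  · rcases eq_or_lt_of_le (not_lt.1 hpq) with h' | h'
    · exact h'.symm
    · exact (this hq hp h.symm h').symm
  exfalso
  have hmem : w q.succ ∈ stepEdge w p := by rw [h]; exact Sym2.mem_mk_right _ _
  rcases Sym2.mem_iff.1 hmem with h1 | h1
  · exact hq p.castSucc (Fin.castSucc_le_castSucc_iff.2 hpq.le) h1.symm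
  · exact hq p.succ (Fin.succ_le_castSucc_iff.2 hpq) h1.symm

-- Every visited vertex other than the starting point is first reached by exactly one new step.
open Classical in
theorem card_image_walk [DecidableEq α] (w : Fin (n + 1) → α) :
    (Finset.univ.image w).card = (Finset.univ.filter (IsNewStep w)).card + 1 := by
  have h1 : Finset.univ.image w
      = insert (w 0) ((Finset.univ.filter (IsNewStep w)).image fun p => w p.succ) := by
    ext v
    simp only [Finset.mem_image, Finset.mem_univ, true_and, Finset.mem_insert, Finset.mem_filter]
    constructor
    · rintro ⟨r, rfl⟩
      induction r using WellFoundedLT.induction with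
      | ind r ih =>
        by_cases hr : ∃ r' < r, w r' = w r
        · obtain ⟨r', hlt, he⟩ := hr
          rw [← he]
          exact ih r' hlt
        · push Not at hr
          rcases Fin.eq_zero_or_eq_succ r with rfl | ⟨p, rfl⟩
          · exact Or.inl rfl
          · exact Or.inr ⟨p, fun r hrp => hr r (Fin.le_castSucc_iff.1 hrp), rfl⟩
    · rintro (rfl | ⟨p, -, rfl⟩)
      exacts [⟨0, rfl⟩, ⟨p.succ, rfl⟩]
  rw [h1, Finset.card_insert_of_notMem, Finset.card_image_of_injOn]
  · intro p hp q hq h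
    simp only [Finset.coe_filter, Finset.mem_univ, true_and, Set.mem_ofPred_eq] at hp hq
    rcases lt_trichotomy p q with h' | h' | h'
    · exact absurd h (hq p.succ (Fin.succ_le_castSucc_iff.2 h'))
    · exact h'
    · exact absurd h.symm (hp q.succ (Fin.succ_le_castSucc_iff.2 h'))
  · simp only [Finset.mem_image, Finset.mem_filter, Finset.mem_univ, true_and, not_exists, not_and]
    intro p hp h
    exact hp 0 (Fin.zero_le _) h.symm

/-- Every edge of the walk is traversed at least twice. -/
def EdgesRepeat (w : Fin (n + 1) → α) : Prop :=
  ∀ p, ∃ q, q ≠ p ∧ stepEdge w q = stepEdge w p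

-- Choose for each step another step `μ p` along the same edge. Two new steps never share an edge,
-- so `μ` injects new steps into old ones; since the vertices number one more than the new steps,
-- the bound follows. In the case of equality `μ` is a bijection from new to old steps, so each edge
-- carries one step of each kind.
open Classical in
theorem card_image_le_of_edgesRepeat [DecidableEq α] {w : Fin (n + 1) → α} (h : EdgesRepeat w) :
    2 * (Finset.univ.image w).card ≤ n + 2 ∧
      (2 * (Finset.univ.image w).card = n + 2 → ∀ q, ¬ IsNewStep w q →
        ∃ p, IsNewStep w p ∧ ∀ q', stepEdge w q' = stepEdge w q ↔ q' = p ∨ q' = q) := by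
  choose μ hμ1 hμ2 using h
  have hmaps : Set.MapsTo μ (Finset.univ.filter (IsNewStep w))
      (Finset.univ.filter fun p => ¬ IsNewStep w p) := by
    intro p hp
    simp only [Finset.coe_filter, Finset.mem_univ, true_and, Set.mem_ofPred_eq] at hp ⊢
    exact fun hn => hμ1 p (hn.eq_of_edge_eq hp (hμ2 p))
  have hinj : Set.InjOn μ (Finset.univ.filter (IsNewStep w)) := by
    intro p hp q hq hpq
    simp only [Finset.coe_filter, Finset.mem_univ, true_and, Set.mem_ofPred_eq] at hp hq
    exact hp.eq_of_edge_eq hq (by rw [← hμ2 p, hpq, hμ2 q])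
  have hle := Finset.card_le_card_of_injOn μ hmaps hinj
  have hsum := Finset.card_filter_add_card_filter_not (s := Finset.univ) (IsNewStep w)
  rw [Finset.card_univ, Fintype.card_fin] at hsum
  rw [card_image_walk]
  refine ⟨by omega, fun heq => ?_⟩
  have hsurj := Finset.surjOn_of_injOn_of_card_le μ hmaps hinj (by omega)
  have key : ∀ q, ¬ IsNewStep w q → ∃ p, IsNewStep w p ∧ μ p = q := by
    intro q hq
    obtain ⟨p, hp, hpq⟩ := hsurj (show q ∈ _ by simpa using hq)
    exact ⟨p, by simpa using hp, hpq⟩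
  intro q hq
  obtain ⟨p, hp, rfl⟩ := key q hq
  refine ⟨p, hp, fun q' => ⟨fun h' => ?_, ?_⟩⟩
  · by_cases hq' : IsNewStep w q'
    · exact Or.inl (hq'.eq_of_edge_eq hp (h'.trans (hμ2 p)))
    · obtain ⟨p', hp', rfl⟩ := key q' hq'
      rw [hμ2, hμ2] at h'
      rw [hp'.eq_of_edge_eq hp h']
      exact Or.inr rfl
  · rintro (rfl | rfl)
    · exact (hμ2 _).symm
    · rfl

/-- If the steps of a walk are paired such that partners traverse the same edge and the first
of two partners leads to a new vertex, then every second partner closes the last pair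
that is still open, in the opposite direction. -/
theorem closes_innermost {w : ℕ → α} {m : ℕ → ℕ}
    (hlt : ∀ p < n, m p < n) (hne : ∀ p < n, m p ≠ p) (hmm : ∀ p < n, m (m p) = p)
    (hedge : ∀ p < n, s(w (m p), w (m p + 1)) = s(w p, w (p + 1)))
    (hnew : ∀ p < n, p < m p → ∀ r ≤ p, w r ≠ w (p + 1)) :
    ∀ p < n, m p < p →
      (∀ s < p, p ≤ m s → s ≤ m p) ∧ w p = w (m p + 1) ∧ w (p + 1) = w (m p) := by
  -- The claim is proved together with a location invariant: at time `p` the walk sits at the vertex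
  -- opened by the innermost open step, or at the root if nothing is open.
  have main : ∀ p ≤ n,
      (((∀ s < p, m s < p) → w p = w 0) ∧
        (∀ s < p, p ≤ m s → (∀ s' < p, p ≤ m s' → s' ≤ s) → w p = w (s + 1))) ∧
      (p < n → m p < p →
        (∀ s < p, p ≤ m s → s ≤ m p) ∧ w p = w (m p + 1) ∧ w (p + 1) = w (m p)) := by
    intro p
    induction p using Nat.strong_induction_on with
    | _ p ih =>
    intro hpn
    have hP : ((∀ s < p, m s < p) → w p = w 0) ∧
        (∀ s < p, p ≤ m s → (∀ s' < p, p ≤ m s' → s' ≤ s) → w p = w (s + 1)) := by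
      rcases Nat.eq_zero_or_eq_succ_pred p with rfl | hp
      · exact ⟨fun _ => rfl, fun s hs => absurd hs (Nat.not_lt_zero _)⟩
      generalize p.pred = k at hp
      subst hp
      have hk : k < n := hpn
      rcases lt_or_gt_of_ne (hne k hk) with hc | ho
      · -- the last step closes a pair
        obtain ⟨hmax, he1, he2⟩ := (ih k (Nat.lt_succ_self k) hk.le).2 hk hc
        have ihs := (ih (m k) (by omega) (by omega)).1
        -- What was open before the pair `(m k, k)` is still open after it: a step closing in
        -- between would close while `m k`, opened later, is still open, against the induction
        -- hypothesis. So the invariant at time `k + 1` is inherited from time `m k`.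
        have hno : ∀ s < m k, m k ≤ m s → k + 1 ≤ m s := by
          intro s hs hms
          by_contra hcon
          have hsn : s < n := by omega
          have h1 : m s ≠ m k := fun h => by
            have := hmm s hsn; rw [h, hmm k hk] at this; omega
          have h2 : m s ≠ k := fun h => by
            have := hmm s hsn; rw [h] at this; omega
          have h3 := (ih (m s) (by omega) (by omega)).2 (hlt s hsn) (by rw [hmm s hsn]; omega)
          have h4 := h3.1 (m k) (by omega) (by rw [hmm k hk]; omega)
          rw [hmm s hsn] at h4
          omega
        constructor
        · intro hall
          rw [he2]
          refine ihs.1 fun s hs => ?_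
          by_contra hcon
          have := hno s hs (by omega)
          have := hall s (by omega)
          omega
        · intro s hs hms hsmax
          rw [he2]
          have hsk : s ≠ k := fun h => by subst h; omega
          have hs1 : s ≤ m k := hmax s (by omega) (by omega)
          have hs2 : s ≠ m k := fun h => by subst h; rw [hmm k hk] at hms; omega
          refine ihs.2 s (by omega) (by omega) fun s' hs' hms' => ?_
          exact hsmax s' (by omega) (hno s' hs' hms')
      · constructor
        · intro hall
          have := hall k (Nat.lt_succ_self k)
          omega
        · intro s hs hms hsmax
          have h1 := hsmax k (Nat.lt_succ_self k) ho
          have : s = k := by omega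
          rw [this]
    refine ⟨hP, fun hp hc => ?_⟩
    have hopen : m p < p ∧ p ≤ m (m p) := ⟨hc, (hmm p hp).ge⟩
    -- the innermost open pair
    obtain ⟨s, hs, hsmax⟩ : ∃ s, (s < p ∧ p ≤ m s) ∧ ∀ s' < p, p ≤ m s' → s' ≤ s := by
      obtain ⟨s, hs, hsm⟩ := Finset.exists_max_image
        ((Finset.range p).filter fun s => p ≤ m s) id ⟨m p, by simpa using hopen⟩
      simp only [Finset.mem_filter, Finset.mem_range, id] at hs hsm
      exact ⟨s, hs, fun s' h1 h2 => hsm s' ⟨h1, h2⟩⟩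
    have hws := hP.2 s hs.1 hs.2 hsmax
    have hle : m p ≤ s := hsmax _ hopen.1 hopen.2
    have hsn : s < n := by omega
    have hsnew := hnew s hsn (by omega)
    -- The walk stands at `w (s + 1)`, an endpoint of the edge of `m p`. If `m p < s`, that endpoint
    -- was visited by time `s`, although step `s` leads to a new vertex.
    have hmem : w (s + 1) ∈ s(w (m p), w (m p + 1)) := by
      rw [hedge p hp, ← hws]; exact Sym2.mem_mk_left _ _
    have hsp : s = m p := by
      by_contra hcon
      rcases Sym2.mem_iff.1 hmem with h | h
      · exact hsnew (m p) hle h.symm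
      · exact hsnew (m p + 1) (by omega) h.symm
    subst hsp
    refine ⟨hsmax, hws, ?_⟩
    have h := hedge p hp
    rw [hws, Sym2.eq_iff] at h
    rcases h with ⟨h1, -⟩ | ⟨h1, -⟩
    -- Traversal in the same direction would make the edge a loop, and a loop never leads to a new
    -- vertex.
    · exact absurd h1 (hsnew _ le_rfl)
    · exact h1.symm
  exact fun p hp => (main p hp.le).2 hp

/-- A walk with repeated edges and the maximal number of vertices runs through every edge exactly
twice, in opposite directions, and the resulting pairing of the steps is non-crossing. -/
theorem exists_pairing_of_card_image_eq [DecidableEq α] {w : Fin (n + 1) → α} (hw : EdgesRepeat w)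
    (hc : 2 * (Finset.univ.image w).card = n + 2) :
    ∃ m : Fin n → Fin n, (∀ p, m p ≠ p) ∧
      (∀ p q, stepEdge w q = stepEdge w p ↔ q = p ∨ q = m p) ∧
      (∀ p, w p.castSucc = w (m p).succ ∧ w p.succ = w (m p).castSucc) ∧
      (∀ s t, s < t → t < m s → m s < m t → False) := by
  have hold := (card_image_le_of_edgesRepeat hw).2 hc
  have hex : ∀ p, ∃ q, q ≠ p ∧ (IsNewStep w p ∨ IsNewStep w q) ∧
      ∀ q', stepEdge w q' = stepEdge w p ↔ q' = p ∨ q' = q := by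
    intro p
    by_cases hp : IsNewStep w p
    · obtain ⟨q, hqp, hq⟩ := hw p
      obtain ⟨p', hp', h⟩ := hold q fun hn => hqp (hn.eq_of_edge_eq hp hq)
      have : p = p' := hp.eq_of_edge_eq hp' (hq.symm.trans ((h p').2 (Or.inl rfl)).symm)
      subst this
      exact ⟨q, hqp, Or.inl hp, fun q' => by rw [← hq]; exact h q'⟩
    · obtain ⟨q, hq, h⟩ := hold p hp
      exact ⟨q, fun h => hp (h ▸ hq), Or.inr hq, fun q' => (h q').trans or_comm⟩
  choose m hne hnew hm using hex
  have hedge : ∀ p, stepEdge w (m p) = stepEdge w p := fun p => (hm p _).2 (Or.inr rfl)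
  have hmm : ∀ p, m (m p) = p := fun p => by
    rcases (hm p (m (m p))).1 ((hedge _).trans (hedge p)) with h | h
    · exact h
    · exact absurd h (hne _)
  -- One partner is new, and it must be the earlier one, since the later one ends at an endpoint of
  -- an edge already used.
  have hnew' : ∀ p, p < m p → IsNewStep w p := by
    intro p hp
    refine (hnew p).resolve_right fun hn => ?_
    have hmem : w (m p).succ ∈ stepEdge w p := by rw [← hedge]; exact Sym2.mem_mk_right _ _
    rcases Sym2.mem_iff.1 hmem with h | h
    · exact hn _ (Fin.castSucc_le_castSucc_iff.2 hp.le) h.symm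
    · exact hn _ (Fin.succ_le_castSucc_iff.2 hp) h.symm
  -- The extensions to `ℕ` take arbitrary default values, as `closes_innermost` only concerns steps
  -- below `n`.
  let w' : ℕ → α := fun r => if h : r < n + 1 then w ⟨r, h⟩ else w 0
  let m' : ℕ → ℕ := fun p => if h : p < n then m ⟨p, h⟩ else 0
  have hm' : ∀ p : Fin n, m' p = m p := fun p => dif_pos p.2
  have hw1 : ∀ p : Fin n, w' p = w p.castSucc := fun p => dif_pos (by omega)
  have hw2 : ∀ p : Fin n, w' (p + 1) = w p.succ := fun p => dif_pos (by omega)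
  have hcl : ∀ p : Fin n, m p < p → (∀ s < p, p ≤ m s → s ≤ m p) ∧
      w p.castSucc = w (m p).succ ∧ w p.succ = w (m p).castSucc := by
    intro p hp
    have := closes_innermost (n := n) (w := w') (m := m') (fun p hp => by
      rw [hm' ⟨p, hp⟩]; exact (m ⟨p, hp⟩).2) (fun p hp => by
      rw [hm' ⟨p, hp⟩]; exact fun h => hne ⟨p, hp⟩ (Fin.ext h)) (fun p hp => by
      rw [hm' ⟨p, hp⟩, hm', hmm]) (fun p hp => by
      rw [hm' ⟨p, hp⟩, hw1, hw2]
      exact (hedge ⟨p, hp⟩).trans (congrArg₂ (fun a b => s(a, b)) (hw1 ⟨p, hp⟩) (hw2 ⟨p, hp⟩)).symm)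
      (fun p hp hlt r hr => by
        rw [hm' ⟨p, hp⟩] at hlt
        have h1 := hw1 ⟨r, by omega⟩
        have h2 := hw2 ⟨p, hp⟩
        simp only at h1 h2
        rw [h1, h2]
        exact hnew' ⟨p, hp⟩ hlt _ (by simpa [Fin.le_def] using hr)) p p.2 (by rw [hm']; exact hp)
    rw [hm', hw1, hw2, hw1, hw2] at this
    refine ⟨fun s hs hsp => this.1 s hs ?_, this.2⟩
    rw [hm']
    exact hsp
  refine ⟨m, hne, hm, fun p => ?_, fun s t hst hts hlt => ?_⟩
  · rcases lt_or_gt_of_ne (hne p) with h | h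
    · exact (hcl p h).2
    · have := (hcl (m p) (by rw [hmm]; exact h)).2
      rw [hmm] at this
      exact ⟨this.2.symm, this.1.symm⟩
  · have := (hcl (m s) (by rw [hmm]; exact hst.trans hts)).1 t hts hlt.le
    rw [hmm] at this
    exact absurd hst (not_lt.2 this)

/-! ### Counting the walks with a given non-crossing pairing -/

/-- The steps `s` of a pairing `m` that are still open at time `p`. -/
def openAt (m : Fin n → Fin n) (p : Fin (n + 1)) : Finset (Fin n) :=
  Finset.univ.filter fun s => s.castSucc < p ∧ p ≤ (m s).castSucc

theorem mem_openAt {m : Fin n → Fin n} {p : Fin (n + 1)} {s : Fin n} :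
    s ∈ openAt m p ↔ s.castSucc < p ∧ p ≤ (m s).castSucc := by
  simp [openAt]

/-- The last step before time `p` that is still open at time `p`. -/
def innermost (m : Fin n → Fin n) (p : Fin (n + 1)) : Option {s : Fin n // s < m s} :=
  if h : (openAt m p).Nonempty then
    some ⟨(openAt m p).max' h, by
      have := mem_openAt.1 ((openAt m p).max'_mem h)
      exact Fin.castSucc_lt_castSucc_iff.1 (this.1.trans_le this.2)⟩
  else none

theorem innermost_congr {m : Fin n → Fin n} {p q : Fin (n + 1)} (h : openAt m p = openAt m q) :
    innermost m p = innermost m q := by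
  simp only [innermost, h]

theorem innermost_eq_none {m : Fin n → Fin n} {p : Fin (n + 1)}
    (h : ∀ s : Fin n, s.castSucc < p → (m s).castSucc < p) : innermost m p = none := by
  rw [innermost, dif_neg]
  rintro ⟨s, hs⟩
  rw [mem_openAt] at hs
  exact absurd (h s hs.1) (not_lt.2 hs.2)

theorem innermost_eq_some {m : Fin n → Fin n} {p : Fin (n + 1)} {s : Fin n} (hs : s < m s)
    (h1 : s.castSucc < p) (h2 : p ≤ (m s).castSucc)
    (h : ∀ s' : Fin n, s'.castSucc < p → p ≤ (m s').castSucc → s' ≤ s) :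
    innermost m p = some ⟨s, hs⟩ := by
  have hmem : s ∈ openAt m p := mem_openAt.2 ⟨h1, h2⟩
  rw [innermost, dif_pos ⟨s, hmem⟩]
  congr 2
  refine le_antisymm (Finset.max'_le _ _ _ fun s' hs' => ?_) (Finset.le_max' _ _ hmem)
  rw [mem_openAt] at hs'
  exact h s' hs'.1 hs'.2

/-- The walk that sits at time `p` at the vertex attached to the innermost open step. -/
def walkOf (m : Fin n → Fin n) (f : Option {s : Fin n // s < m s} → α) (p : Fin (n + 1)) : α :=
  f (innermost m p)

theorem innermost_succ {m : Fin n → Fin n} (p : Fin n) (hp : p < m p) :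
    innermost m p.succ = some ⟨p, hp⟩ :=
  innermost_eq_some hp (Fin.castSucc_lt_succ_iff.2 le_rfl) (Fin.succ_le_castSucc_iff.2 hp)
    fun _ hs' _ => Fin.castSucc_lt_succ_iff.1 hs'

theorem innermost_zero (m : Fin n → Fin n) : innermost m 0 = none :=
  innermost_eq_none fun _ h => absurd h (Fin.not_lt_zero _)

theorem innermost_last (m : Fin n → Fin n) : innermost m (Fin.last n) = none :=
  innermost_eq_none fun _ _ => Fin.castSucc_lt_last _

section Pairing

/-- A fixed point free involution whose orbits do not cross. -/
structure IsNonCrossingPairing (m : Fin n → Fin n) : Prop where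
  ne : ∀ p, m p ≠ p
  inv : ∀ p, m (m p) = p
  nc : ∀ s t, s < t → t < m s → m s < m t → False

variable {m : Fin n → Fin n}

theorem innermost_castSucc (hm : IsNonCrossingPairing m) (p : Fin n) (hp : m p < p) :
    innermost m p.castSucc = some ⟨m p, (hm.inv p).symm ▸ hp⟩ := by
  refine innermost_eq_some _ (Fin.castSucc_lt_castSucc_iff.2 hp) (by rw [hm.inv]) fun s' h1 h2 => ?_
  rw [Fin.castSucc_lt_castSucc_iff] at h1
  rw [Fin.castSucc_le_castSucc_iff] at h2
  by_contra hcon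
  rw [not_le] at hcon
  rcases h2.lt_or_eq with h3 | h3
  · exact hm.nc (m p) s' hcon (by rwa [hm.inv]) (by rwa [hm.inv])
  · rw [h3, hm.inv] at hcon
    exact lt_irrefl _ hcon

/-- The same steps are open just before a pair opens and just after it closes: any difference would
be a pair with exactly one member strictly between `m p` and `p`, that is, a crossing. -/
theorem innermost_reopen (hm : IsNonCrossingPairing m) (p : Fin n) (hp : m p < p) :
    innermost m (m p).castSucc = innermost m p.succ := by
  refine innermost_congr ?_
  ext s
  rw [mem_openAt, mem_openAt, Fin.castSucc_lt_castSucc_iff, Fin.castSucc_le_castSucc_iff,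
    Fin.castSucc_lt_succ_iff, Fin.succ_le_castSucc_iff]
  have hnc1 := hm.nc s (m p)
  have hnc2 := hm.nc (m p) s
  have hms := hm.inv s
  have hs := hm.ne s
  rw [hm.inv] at hnc1 hnc2
  constructor
  · rintro ⟨h1, h2⟩
    refine ⟨(h1.trans hp).le, ?_⟩
    have h3 : m p ≠ m s := fun h => by
      have h' := congrArg m h
      rw [hm.inv, hm.inv] at h'
      subst h'
      exact lt_asymm h1 hp
    have h4 : m s ≠ p := fun h => by rw [← h, hm.inv] at h1; exact lt_irrefl _ h1
    by_contra hcon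
    exact hnc1 h1 (lt_of_le_of_ne h2 h3) (lt_of_le_of_ne (not_lt.1 hcon) h4)
  · rintro ⟨h1, h2⟩
    have h3 : s ≠ p := fun h => by rw [h] at h2; exact lt_asymm h2 hp
    have h4 : s ≠ m p := fun h => by rw [h, hm.inv] at h2; exact lt_irrefl _ h2
    have h5 : s < m p := by
      by_contra hcon
      exact hnc2 (lt_of_le_of_ne (not_lt.1 hcon) h4.symm) (lt_of_le_of_ne h1 h3) h2
    exact ⟨h5, (hp.trans h2).le⟩

theorem walkOf_opposite (hm : IsNonCrossingPairing m) (f : Option {s : Fin n // s < m s} → α) (p : Fin n) :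
    walkOf m f p.castSucc = walkOf m f (m p).succ ∧
      walkOf m f p.succ = walkOf m f (m p).castSucc := by
  wlog h : m p < p generalizing p
  · have h' : p < m p := lt_of_le_of_ne (not_lt.1 h) (hm.ne p).symm
    have := this (m p) (by rwa [hm.inv])
    rw [hm.inv] at this
    exact ⟨this.2.symm, this.1.symm⟩
  refine ⟨?_, congrArg f (innermost_reopen hm p h).symm⟩
  rw [walkOf, walkOf, innermost_castSucc hm p h,
    innermost_succ (m p) ((hm.inv p).symm ▸ h)]

theorem card_openers (hm : IsNonCrossingPairing m) : 2 * Fintype.card {s : Fin n // s < m s} = n := by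
  have h1 : Fintype.card {s : Fin n // s < m s} = Fintype.card {s : Fin n // ¬ s < m s} := by
    refine Fintype.card_congr ⟨fun s => ⟨m s, ?_⟩, fun s => ⟨m s, ?_⟩, fun s => ?_, fun s => ?_⟩
    · rw [hm.inv]; exact not_lt.2 s.2.le
    · rw [hm.inv]; exact lt_of_le_of_ne (not_lt.1 s.2) (hm.ne s)
    · exact Subtype.ext (hm.inv s)
    · exact Subtype.ext (hm.inv s)
  have h2 := Fintype.card_subtype_compl fun s : Fin n => s < m s
  have h3 := Fintype.card_subtype_le fun s : Fin n => s < m s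
  rw [Fintype.card_fin] at h2 h3
  omega

open Classical in
/-- The closed walks on `N` vertices that traverse the edges in pairs according to a given
non-crossing pairing and visit the maximal number of vertices correspond to the injective labelings
of the pairs and of the root. -/
theorem card_walks_of_pairing (hm : IsNonCrossingPairing m) (N : ℕ) :
    (Finset.univ.filter fun w : Fin (n + 1) → Fin N =>
      (w 0 = w (Fin.last n) ∧ EdgesRepeat w ∧ 2 * (Finset.univ.image w).card = n + 2) ∧
        ∀ p q, stepEdge w q = stepEdge w p ↔ q = p ∨ q = m p).card
      = N.descFactorial (n / 2 + 1) := by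
  have hop := card_openers hm
  have hcard : Fintype.card (Option {s : Fin n // s < m s}) = n / 2 + 1 := by
    rw [Fintype.card_option]; omega
  have hinj : Function.Injective fun f : Option {s : Fin n // s < m s} ↪ Fin N => walkOf m f := by
    intro f g hfg
    ext x
    congr 1
    rcases x with _ | s
    · have := congrFun hfg 0
      simpa only [walkOf, innermost_zero] using this
    · have := congrFun hfg s.1.succ
      simpa only [walkOf, innermost_succ s.1 s.2] using this
  rw [← hcard, ← Fintype.card_fin N, ← Fintype.card_embedding_eq, Fintype.card_fin,
    ← Finset.card_univ, ← Finset.card_image_of_injective Finset.univ hinj]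
  congr 1
  ext w
  simp only [Finset.mem_filter, Finset.mem_univ, true_and, Finset.mem_image]
  constructor
  · rintro ⟨⟨-, hw, hc⟩, hker⟩
    obtain ⟨m₀, hne₀, hker₀, hopp, -⟩ := exists_pairing_of_card_image_eq hw hc
    have hm₀ : m₀ = m := by
      funext p
      exact ((hker p (m₀ p)).1 ((hker₀ p _).2 (Or.inr rfl))).resolve_left (hne₀ p)
    subst hm₀
    let f : Option {s : Fin n // s < m₀ s} → Fin N := fun x => x.elim (w 0) fun s => w s.1.succ
    have hf : walkOf m₀ f = w := by
      funext r
      induction r using WellFoundedLT.induction with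
      | ind r ih =>
        rcases Fin.eq_zero_or_eq_succ r with rfl | ⟨p, rfl⟩
        · rw [walkOf, innermost_zero]; rfl
        · rcases lt_or_gt_of_ne (hm.ne p) with h | h
          · rw [walkOf, ← innermost_reopen hm p h, (hopp p).2]
            exact ih _ (Fin.castSucc_lt_succ_iff.2 h.le)
          · rw [walkOf, innermost_succ p h]; rfl
    -- The range of `f` contains all `n / 2 + 1` vertices of the walk, and the domain has exactly
    -- that many elements.
    have hfi : Function.Injective f := by
      have h1 : Finset.univ.image w ⊆ Finset.univ.image f := by
        rw [← hf]
        intro v hv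
        obtain ⟨r, -, rfl⟩ := Finset.mem_image.1 hv
        exact Finset.mem_image_of_mem _ (Finset.mem_univ _)
      have h2 := Finset.card_le_card h1
      have h3 : (Finset.univ.image f).card ≤ _ := Finset.card_image_le
      rw [Finset.card_univ, hcard] at h3
      have h4 : (Finset.univ.image f).card =
          (Finset.univ : Finset (Option {s : Fin n // s < m₀ s})).card := by
        rw [Finset.card_univ, hcard]; omega
      simpa using Finset.card_image_iff.1 h4
    exact ⟨⟨f, hfi⟩, hf⟩
  · rintro ⟨f, rfl⟩
    have hopp := walkOf_opposite hm f
    have hedge : ∀ p, stepEdge (walkOf m f) (m p) = stepEdge (walkOf m f) p := fun p => by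
      rw [stepEdge, stepEdge, (hopp p).1, (hopp p).2, Sym2.eq_swap]
    have hrep : EdgesRepeat (walkOf m f) := fun p => ⟨m p, hm.ne p, hedge p⟩
    have himg : Finset.univ.image (walkOf m f) = Finset.univ.image f := by
      ext v
      simp only [Finset.mem_image, Finset.mem_univ, true_and]
      constructor
      · rintro ⟨r, rfl⟩; exact ⟨_, rfl⟩
      · rintro ⟨_ | s, rfl⟩
        · exact ⟨0, by rw [walkOf, innermost_zero]⟩
        · exact ⟨s.1.succ, by rw [walkOf, innermost_succ s.1 s.2]⟩
    have hc : 2 * (Finset.univ.image (walkOf m f)).card = n + 2 := by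
      rw [himg, Finset.card_image_of_injective _ f.injective, Finset.card_univ, hcard]; omega
    obtain ⟨m₀, hne₀, hker₀, -, -⟩ := exists_pairing_of_card_image_eq hrep hc
    have hm₀ : ∀ p, m p = m₀ p := fun p =>
      ((hker₀ p (m p)).1 (hedge p)).resolve_left (hm.ne p)
    refine ⟨⟨?_, hrep, hc⟩, fun p q => by rw [hm₀]; exact hker₀ p q⟩
    rw [walkOf, walkOf, innermost_zero, innermost_last]

end Pairing

/-- A map with at most `k` values factors through `Fin k`; the bound counts the pairs of factors. -/
theorem card_filter_card_image_le {ι β : Type*} [Fintype ι] [Nonempty ι] [DecidableEq ι]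
    [Fintype β] [DecidableEq β] (k : ℕ) :
    (Finset.univ.filter fun f : ι → β => (Finset.univ.image f).card ≤ k).card
      ≤ k ^ Fintype.card ι * Fintype.card β ^ k := by
  have hsub : (Finset.univ.filter fun f : ι → β => (Finset.univ.image f).card ≤ k) ⊆
      Finset.univ.image fun x : (ι → Fin k) × (Fin k → β) => x.2 ∘ x.1 := by
    intro f hf
    simp only [Finset.mem_filter, Finset.mem_univ, true_and] at hf
    obtain ⟨emb⟩ : Nonempty (Finset.univ.image f ↪ Fin k) :=
      Function.Embedding.nonempty_of_card_le (by rwa [Fintype.card_coe, Fintype.card_fin])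
    let h : ι → Fin k := fun x => emb ⟨f x, Finset.mem_image_of_mem _ (Finset.mem_univ x)⟩
    refine Finset.mem_image.2 ⟨(h, fun j => f (Function.invFun h j)), Finset.mem_univ _, ?_⟩
    funext x
    have h1 : h (Function.invFun h (h x)) = h x := Function.invFun_eq ⟨x, rfl⟩
    exact congrArg Subtype.val (emb.injective h1)
  refine (Finset.card_le_card hsub).trans (Finset.card_image_le.trans ?_)
  simp

end Walks

/-! ### Expectations of products of matrix entries -/

section Expectation

theorem integrable_prod_LInfMinus {Ω : Type*} [MeasurableSpace Ω] {P : Measure Ω}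
    [IsProbabilityMeasure P] {ι : Type*} (s : Finset ι) (f : ι → LInfMinus P) :
    Integrable (fun ω => ∏ i ∈ s, (f i).1 ω) P := by
  have hmem : ∏ i ∈ s, (f i).1 ∈ LInfMinus P :=
    Finset.prod_induction _ (· ∈ LInfMinus P) (fun _ _ => mul_mem_LInfMinus) (unitRV P).2
      fun i _ => (f i).2
  exact (integrable_LInfMinus ⟨_, hmem⟩).congr (AEEqFun.coeFn_fun_finsetProd s fun i => (f i).1)

/-- The expectation of a product of entries factors over the unoriented edges of the entries. -/
theorem integral_prod_eq_prod_edges {Ω K : Type*} [MeasurableSpace Ω] {P : Measure Ω}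
    {N : ℕ} {X : K → Matrix (Fin N) (Fin N) (LInfMinus P)}
    (hself : ∀ k i j, (X k j i).1 = star (X k i j).1)
    (hindep : iIndepFun (fun (q : {q : Fin N × Fin N // q.1 ≤ q.2}) (ω : Ω) (k : K) =>
      (X k q.1.1 q.1.2).1 ω) P)
    {n : ℕ} (χ : Fin n → K) (lam : Fin n → Fin N × Fin N) :
    ∫ ω, ∏ t, (X (χ t) (lam t).1 (lam t).2).1 ω ∂P =
      ∏ e : Sym2 (Fin N), ∫ ω, ∏ t with s((lam t).1, (lam t).2) = e,
        (X (χ t) (lam t).1 (lam t).2).1 ω ∂P := by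
  -- Independence is only assumed on and above the diagonal. By self-adjointness each entry is the
  -- entry at the sorted position or its conjugate, hence a measurable function of the family
  -- attached to its edge.
  let g : Fin n → (K → ℂ) → ℂ := fun t y =>
    if (lam t).1 ≤ (lam t).2 then y (χ t) else star (y (χ t))
  have hg : ∀ t, Measurable (g t) := by
    intro t
    have h0 : Measurable fun y : K → ℂ => y (χ t) := measurable_pi_apply (χ t)
    by_cases h : (lam t).1 ≤ (lam t).2
    · simpa only [g, if_pos h] using h0
    · simp only [g, if_neg h]
      exact continuous_star.measurable.comp h0
  let Y : Sym2 (Fin N) → Ω → K → ℂ := fun e ω k =>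
    (X k (Sym2.sortEquiv e).1.1 (Sym2.sortEquiv e).1.2).1 ω
  have hY : iIndepFun Y P := hindep.precomp Sym2.sortEquiv.injective
  have hae : ∀ᵐ ω ∂P, ∀ t, (X (χ t) (lam t).1 (lam t).2).1 ω =
      g t (Y s((lam t).1, (lam t).2) ω) := by
    rw [ae_all_iff]
    intro t
    by_cases h : (lam t).1 ≤ (lam t).2
    · refine Eventually.of_forall fun ω => ?_
      simp [g, Y, h]
    · have h' := (not_le.1 h).le
      filter_upwards [AEEqFun.coeFn_star (X (χ t) (lam t).2 (lam t).1).1] with ω hω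
      rw [hself (χ t) (lam t).2 (lam t).1, hω]
      simp [g, Y, h, h']
  have hprod : ∀ f : Fin n → ℂ, ∏ t, f t =
      ∏ e : Sym2 (Fin N), ∏ t with s((lam t).1, (lam t).2) = e, f t := fun f =>
    (Finset.prod_fiberwise _ _ _).symm
  let h : Sym2 (Fin N) → (K → ℂ) → ℂ := fun e y =>
    ∏ t with s((lam t).1, (lam t).2) = e, g t y
  have hh : ∀ e, Measurable (h e) := fun e => Finset.measurable_fun_prod _ fun t _ => hg t
  have hfac : ∀ᵐ ω ∂P, ∀ e, ∏ t with s((lam t).1, (lam t).2) = e,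
      (X (χ t) (lam t).1 (lam t).2).1 ω = h e (Y e ω) := by
    filter_upwards [hae] with ω hω e
    refine Finset.prod_congr rfl fun t ht => ?_
    rw [hω, (Finset.mem_filter.1 ht).2]
  have hmeas : ∀ e, AEStronglyMeasurable (fun ω => h e (Y e ω)) P := by
    intro e
    have : AEStronglyMeasurable (fun ω => ∏ t with s((lam t).1, (lam t).2) = e,
        (X (χ t) (lam t).1 (lam t).2).1 ω) P :=
      Finset.aestronglyMeasurable_fun_prod _ fun t _ => AEEqFun.aestronglyMeasurable _
    exact this.congr (hfac.mono fun ω hω => hω e)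
  calc ∫ ω, ∏ t, (X (χ t) (lam t).1 (lam t).2).1 ω ∂P
      = ∫ ω, ∏ e, h e (Y e ω) ∂P := by
        refine integral_congr_ae ?_
        filter_upwards [hfac] with ω hω
        rw [hprod]
        exact Finset.prod_congr rfl fun e _ => hω e
    _ = ∏ e, ∫ ω, h e (Y e ω) ∂P :=
        (hY.comp h hh).integral_fun_prod_eq_prod_integral hmeas
    _ = _ := Finset.prod_congr rfl fun e _ =>
        integral_congr_ae (hfac.mono fun ω hω => (hω e).symm)

variable {I J : Type*} {C : Matrix (I ⊕ J) (I ⊕ J) ℝ}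
  {Ω : ℕ → Type*} [∀ N, MeasurableSpace (Ω N)] {P : ∀ N, Measure (Ω N)}
  {X : ∀ N : ℕ, I ⊕ J → Matrix (Fin N) (Fin N) (LInfMinus (P N))}
  {n : ℕ} (χ : Fin n → I ⊕ J)

/-- The edge met only once contributes the mean of a single centered entry. -/
theorem integral_prod_eq_zero (hX : IsRandomTwoFaced C P X) {N : ℕ} (lam : Fin n → Fin N × Fin N)
    (h : ∃ t, ∀ t', s((lam t').1, (lam t').2) = s((lam t).1, (lam t).2) → t' = t) :
    ∫ ω, ∏ t, (X N (χ t) (lam t).1 (lam t).2).1 ω ∂(P N) = 0 := by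
  obtain ⟨t, ht⟩ := h
  rw [integral_prod_eq_prod_edges (hX.selfAdjoint N) (hX.indep N) χ lam]
  refine Finset.prod_eq_zero (Finset.mem_univ s((lam t).1, (lam t).2)) ?_
  have : (Finset.univ.filter fun t' => s((lam t').1, (lam t').2) = s((lam t).1, (lam t).2))
      = {t} := by
    ext t'
    simp only [Finset.mem_filter, Finset.mem_univ, true_and, Finset.mem_singleton]
    exact ⟨ht t', fun h => by rw [h]⟩
  simp only [this, Finset.prod_singleton]
  exact hX.centered _ _ _ _

/-- The number of edges grows with `N`, but the positions lying on one edge form one of finitely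
many subsets of `Fin n`. The moment bounds for the corresponding subwords therefore give constants
uniform in `N` and `lam`, and the exponents add up to `n`. -/
theorem exists_norm_integral_prod_le [∀ N, IsProbabilityMeasure (P N)]
    (hX : IsRandomTwoFaced C P X) :
    ∃ A : ℝ, 0 ≤ A ∧ ∃ N₀ : ℕ, ∀ N, N₀ < N → ∀ lam : Fin n → Fin N × Fin N,
      ‖∫ ω, ∏ t, (X N (χ t) (lam t).1 (lam t).2).1 ω ∂(P N)‖
        ≤ (A * (N : ℝ) ^ (-(1 / 2) : ℝ)) ^ n := by
  choose M hM N₁ hN₁ using fun S : Finset (Fin n) =>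
    hX.moment_bound S.card (χ ∘ S.orderEmbOfFin rfl)
  -- The summand `1` gives `M S ≤ A ≤ A ^ S.card` for nonempty `S`, so one factor `A` can be charged
  -- to each position.
  have hA1 : 1 ≤ 1 + ∑ S, M S := by
    have := Finset.sum_nonneg fun S (_ : S ∈ Finset.univ) => (hM S).le
    linarith
  have hMA : ∀ S, M S ≤ 1 + ∑ S, M S := fun S => by
    have := Finset.single_le_sum (fun S _ => (hM S).le) (Finset.mem_univ S)
    linarith
  generalize 1 + ∑ S, M S = A at hA1 hMA
  refine ⟨A, by linarith, ∑ S, N₁ S, fun N hN lam => ?_⟩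
  rw [integral_prod_eq_prod_edges (hX.selfAdjoint N) (hX.indep N) χ lam, norm_prod]
  have hcard : ∑ e : Sym2 (Fin N),
      (Finset.univ.filter fun t => s((lam t).1, (lam t).2) = e).card = n := by
    rw [← Finset.card_eq_sum_card_fiberwise fun _ _ => by simp, Finset.card_univ, Fintype.card_fin]
  conv_rhs => rw [← hcard]
  rw [← Finset.prod_pow_eq_pow_sum]
  refine Finset.prod_le_prod (fun _ _ => norm_nonneg _) fun e _ => ?_
  set S := Finset.univ.filter fun t => s((lam t).1, (lam t).2) = e with hS
  rcases S.eq_empty_or_nonempty with h0 | h0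
  · simp [h0]
  have hbd := hN₁ S N ((Finset.single_le_sum (fun _ _ => Nat.zero_le _)
    (Finset.mem_univ S)).trans_lt hN) (Sym2.sortEquiv e).1.1 (Sym2.sortEquiv e).1.2
    (Sym2.sortEquiv e).2 (lam ∘ S.orderEmbOfFin rfl) (fun l => by
      have hl : s((lam (S.orderEmbOfFin rfl l)).1, (lam (S.orderEmbOfFin rfl l)).2) = e :=
        (Finset.mem_filter.1 (S.orderEmbOfFin_mem rfl l)).2
      rw [← hl]
      rcases le_total (lam (S.orderEmbOfFin rfl l)).1 (lam (S.orderEmbOfFin rfl l)).2 with h | h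
      · left; simp [h]
      · right; simp [h])
  have hprod : ∀ f : Fin n → ℂ, ∏ t ∈ S, f t = ∏ l, f (S.orderEmbOfFin rfl l) := by
    intro f
    rw [← Finset.prod_coe_sort S]
    exact (Fintype.prod_equiv (S.orderIsoOfFin rfl).toEquiv _ _ fun l => rfl).symm
  simp only [hprod]
  refine hbd.trans ?_
  rw [mul_pow]
  have hpow : (N : ℝ) ^ (-(S.card : ℝ) / 2) = ((N : ℝ) ^ (-(1 / 2) : ℝ)) ^ S.card := by
    rw [← Real.rpow_natCast, ← Real.rpow_mul (Nat.cast_nonneg N)]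
    congr 1
    ring
  rw [hpow]
  refine mul_le_mul_of_nonneg_right ?_ (by positivity)
  exact (hMA S).trans (le_self_pow₀ hA1 h0.card_pos.ne')

/-- If the entries are paired with entries at transposed positions, the expectation is a product
of covariances. -/
theorem integral_prod_eq_prod_covariance [∀ N, IsProbabilityMeasure (P N)]
    (hX : IsRandomTwoFaced C P X) {N : ℕ}
    (lam : Fin n → Fin N × Fin N) (π : Finpartition (Finset.univ : Finset (Fin n)))
    (hπ : ∀ s t, s ∈ π.part t ↔ s((lam s).1, (lam s).2) = s((lam t).1, (lam t).2))
    (h2 : ∀ V ∈ π.parts, V.card = 2)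
    (hopp : ∀ s t, s ≠ t → s ∈ π.part t → lam s = (lam t).swap)
    (κ : Finset (Fin n) → ℂ) (hκ : ∀ s t, s ≠ t → κ {s, t} = (C (χ s) (χ t) : ℂ)) :
    ∫ ω, ∏ t, (X N (χ t) (lam t).1 (lam t).2).1 ω ∂(P N) = ∏ V ∈ π.parts, κ V / N := by
  let F : Finset (Fin n) → ℂ := fun V =>
    ∫ ω, ∏ t ∈ V, (X N (χ t) (lam t).1 (lam t).2).1 ω ∂(P N)
  let fib : Sym2 (Fin N) → Finset (Fin n) := fun e =>
    Finset.univ.filter fun t => s((lam t).1, (lam t).2) = e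
  have hfib : ∀ t, π.part t = fib s((lam t).1, (lam t).2) := by
    intro t
    ext s
    simp [fib, hπ]
  have hparts : π.parts
      = (Finset.univ.image fun t => s((lam t).1, (lam t).2)).image fib := by
    ext V
    simp only [Finset.mem_image, Finset.mem_univ, true_and, exists_exists_eq_and]
    constructor
    · intro hV
      obtain ⟨t, ht⟩ := π.nonempty_of_mem_parts hV
      exact ⟨t, by rw [← hfib, π.part_eq_of_mem hV ht]⟩
    · rintro ⟨t, rfl⟩
      rw [← hfib]
      exact π.part_mem.2 (Finset.mem_univ t)
  -- Blocks correspond to the edges that occur; every other edge contributes an empty product, of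
  -- expectation `1`.
  have hedges : ∏ e, F (fib e) = ∏ V ∈ π.parts, F V := by
    rw [hparts, Finset.prod_image]
    · refine (Finset.prod_subset (Finset.subset_univ _) fun e _ he => ?_).symm
      have : fib e = ∅ := by
        refine Finset.filter_eq_empty_iff.2 fun t _ ht => he ?_
        exact Finset.mem_image.2 ⟨t, Finset.mem_univ t, ht⟩
      simp [F, this]
    · intro e he e' _ hee
      obtain ⟨t, -, rfl⟩ := Finset.mem_image.1 he
      have : t ∈ fib s((lam t).1, (lam t).2) := by simp [fib]
      rw [hee] at this
      exact (Finset.mem_filter.1 this).2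
  rw [integral_prod_eq_prod_edges (hX.selfAdjoint N) (hX.indep N) χ lam]
  refine hedges.trans (Finset.prod_congr rfl fun V hV => ?_)
  obtain ⟨s, t, hst, rfl⟩ := Finset.card_eq_two.1 (h2 V hV)
  have hs : s ∈ π.part t := by
    rw [π.part_eq_of_mem hV (by simp)]
    simp
  have hl := hopp s t hst hs
  simp only [F, Finset.prod_pair hst]
  rw [hl, hκ s t hst]
  exact hX.covariance N (χ s) (χ t) (lam t).2 (lam t).1

end Expectation

/-! ### Products of left and right matrices -/

section Operators

/-- The positions of a word: first the left ones increasingly, then the right ones decreasingly. -/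
def chiOrder {I J : Type*} {n : ℕ} (χ : Fin n → I ⊕ J) : List (Fin n) :=
  (List.finRange n).filter (fun t => (χ t).isLeft) ++
    ((List.finRange n).filter fun t => !(χ t).isLeft).reverse

theorem exists_equiv_eq_ofFn {n : ℕ} {R : Fin n → Fin n → Prop} {l : List (Fin n)}
    (hl : l.Perm (List.finRange n)) (hR : l.Pairwise R) :
    ∃ σ : Fin n ≃ Fin n, l = List.ofFn σ ∧ ∀ p q, p < q → R (σ p) (σ q) := by
  have hlen : l.length = n := by rw [hl.length_eq, List.length_finRange]
  have hnd : l.Nodup := hl.nodup_iff.2 (List.nodup_finRange n)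
  let f : Fin n → Fin n := fun p => l.get (p.cast hlen.symm)
  have hf : Function.Injective f := fun p q h => by
    simpa using hnd.injective_get h
  refine ⟨Equiv.ofBijective f (Finite.injective_iff_bijective.1 hf), ?_, fun p q hpq => ?_⟩
  · refine List.ext_get (by simp [hlen]) fun i h1 h2 => ?_
    simp [f]
  · exact List.pairwise_iff_get.1 hR _ _ (by simpa using hpq)

theorem chiOrder_perm {I J : Type*} {n : ℕ} (χ : Fin n → I ⊕ J) :
    (chiOrder χ).Perm (List.finRange n) :=
  ((List.reverse_perm _).append_left _).trans (List.filter_append_perm _ _)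

theorem chiOrder_pairwise {I J : Type*} {n : ℕ} (χ : Fin n → I ⊕ J) :
    (chiOrder χ).Pairwise (chiLT fun t => sideOf (χ t)) := by
  have hlt : (List.finRange n).Pairwise (· < ·) := List.pairwise_lt_finRange n
  have hl : ∀ {t}, (χ t).isLeft = true → sideOf (χ t) = Side.left := by
    intro t ht
    obtain ⟨i, hi⟩ := Sum.isLeft_iff.1 ht
    rw [hi]; rfl
  have hr : ∀ {t}, (!(χ t).isLeft) = true → sideOf (χ t) = Side.right := by
    intro t ht
    obtain ⟨i, hi⟩ := Sum.isRight_iff.1 (by simpa using ht)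
    rw [hi]; rfl
  refine List.pairwise_append.2 ⟨?_, List.pairwise_reverse.2 ?_, ?_⟩
  · refine (hlt.filter _).imp_of_mem fun {s t} hs ht hst => ?_
    simp only [chiLT, hl (List.mem_filter.1 hs).2, hl (List.mem_filter.1 ht).2]
    exact hst
  · refine (hlt.filter _).imp_of_mem fun {s t} hs ht hst => ?_
    simp only [chiLT, hr (List.mem_filter.1 hs).2, hr (List.mem_filter.1 ht).2]
    exact hst
  · intro s hs t ht
    simp only [chiLT, hl (List.mem_filter.1 hs).2,
      hr (List.mem_filter.1 (List.mem_reverse.1 ht)).2]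

theorem chiLT_asymm {n : ℕ} {χ : Fin n → Side} {s t : Fin n} (h : chiLT χ s t) :
    ¬ chiLT χ t s := by
  unfold chiLT at h ⊢
  cases hs : χ s <;> cases ht : χ t <;> simp_all [le_of_lt]

/-- The total order attached to a word, as an enumeration of the positions. -/
theorem exists_chiOrder_equiv {I J : Type*} {n : ℕ} (χ : Fin n → I ⊕ J) :
    ∃ σ : Fin n ≃ Fin n, chiOrder χ = List.ofFn σ ∧
      ∀ s t, chiLT (fun t => sideOf (χ t)) s t ↔ σ.symm s < σ.symm t := by
  obtain ⟨σ, h1, h2⟩ := exists_equiv_eq_ofFn (chiOrder_perm χ) (chiOrder_pairwise χ)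
  have h3 : ∀ s t, σ.symm s < σ.symm t → chiLT (fun t => sideOf (χ t)) s t := fun s t h => by
    simpa using h2 _ _ h
  refine ⟨σ, h1, fun s t => ⟨fun h => ?_, h3 s t⟩⟩
  rcases lt_trichotomy (σ.symm s) (σ.symm t) with h' | h' | h'
  · exact h'
  · rw [σ.symm.injective h'] at h
    exact absurd h (chiLT_asymm h)
  · exact absurd h (chiLT_asymm (h3 _ _ h'))

variable {Ω : Type*} [MeasurableSpace Ω] {P : Measure Ω} {I J : Type*} {N : ℕ}

/-- The matrix of the values of random variables. -/
noncomputable def evalMat (T : Matrix (Fin N) (Fin N) (LInfMinus P)) (ω : Ω) : Matrix (Fin N) (Fin N) ℂ :=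
  Matrix.of fun i j => (T i j).1 ω

theorem coeFn_sum_mulOp (f g : Fin N → LInfMinus P) :
    (∑ k, mulOp (f k) (g k) : LInfMinus P).1 =ᵐ[P] fun ω => ∑ k, (f k).1 ω * (g k).1 ω := by
  have h1 : (∑ k, mulOp (f k) (g k) : LInfMinus P).1 = ∑ k, (f k).1 * (g k).1 := by
    rw [Submodule.coe_sum]; rfl
  rw [h1]
  have h2 : ∀ᵐ ω ∂P, ∀ k, ((f k).1 * (g k).1) ω = (f k).1 ω * (g k).1 ω :=
    ae_all_iff.2 fun k => AEEqFun.coeFn_mul _ _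
  filter_upwards [AEEqFun.coeFn_fun_finsetSum Finset.univ fun k => (f k).1 * (g k).1, h2]
    with ω h3 h4
  rw [h3]
  exact Finset.sum_congr rfl fun k _ => h4 k

theorem evalMat_faceOp (X : I ⊕ J → Matrix (Fin N) (Fin N) (LInfMinus P)) (k : I ⊕ J)
    (η : Matrix (Fin N) (Fin N) (LInfMinus P)) :
    ∀ᵐ ω ∂P, evalMat (faceOp X k η) ω = if k.isLeft then evalMat (X k) ω * evalMat η ω
      else evalMat η ω * evalMat (X k) ω := by
  rcases k with k | k
  · have : ∀ᵐ ω ∂P, ∀ i j, (faceOp X (Sum.inl k) η i j).1 ω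
        = ∑ r, (X (Sum.inl k) i r).1 ω * (η r j).1 ω :=
      ae_all_iff.2 fun i => ae_all_iff.2 fun j => coeFn_sum_mulOp _ _
    filter_upwards [this] with ω hω
    ext i j
    simpa [evalMat, Matrix.mul_apply] using hω i j
  · have : ∀ᵐ ω ∂P, ∀ i j, (faceOp X (Sum.inr k) η i j).1 ω
        = ∑ r, (X (Sum.inr k) r j).1 ω * (η i r).1 ω :=
      ae_all_iff.2 fun i => ae_all_iff.2 fun j => coeFn_sum_mulOp _ _
    filter_upwards [this] with ω hω
    ext i j
    simpa [evalMat, Matrix.mul_apply, mul_comm] using hω i j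

/-- The first operator of the word acts last, so its matrix is the outermost factor on its side.
Left matrices hence keep their order and right matrices appear reversed. -/
theorem evalMat_prod_faceOp (X : I ⊕ J → Matrix (Fin N) (Fin N) (LInfMinus P)) {n : ℕ}
    (χ : Fin n → I ⊕ J) (η : Matrix (Fin N) (Fin N) (LInfMinus P)) (l : List (Fin n)) :
    ∀ᵐ ω ∂P, evalMat ((l.map fun t => faceOp X (χ t)).prod η) ω =
      ((l.filter fun t => (χ t).isLeft).map fun t => evalMat (X (χ t)) ω).prod * evalMat η ω *
        (((l.filter fun t => !(χ t).isLeft).reverse).map fun t => evalMat (X (χ t)) ω).prod := by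
  induction l with
  | nil => simp
  | cons t l ih =>
    filter_upwards [ih, evalMat_faceOp X (χ t) ((l.map fun t => faceOp X (χ t)).prod η)]
      with ω h1 h2
    rw [List.map_cons, List.prod_cons, Module.End.mul_apply, h2, h1]
    cases h : (χ t).isLeft <;>
      simp only [h, List.filter_cons, Bool.not_false, Bool.not_true, Bool.false_eq_true, if_true,
        if_false, List.reverse_cons, List.map_append, List.prod_append, List.map_cons,
        List.map_nil, List.prod_cons, List.prod_nil, mul_one, mul_assoc]

theorem evalMat_prod_faceOp_diagonal [IsProbabilityMeasure P]
    (X : I ⊕ J → Matrix (Fin N) (Fin N) (LInfMinus P)) {n : ℕ} (χ : Fin n → I ⊕ J) :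
    ∀ᵐ ω ∂P, evalMat ((List.ofFn fun t => faceOp X (χ t)).prod
        (Matrix.diagonal fun _ => unitRV P)) ω =
      ((chiOrder χ).map fun t => evalMat (X (χ t)) ω).prod := by
  filter_upwards [evalMat_prod_faceOp X χ (Matrix.diagonal fun _ => unitRV P) (List.finRange n),
    AEEqFun.coeFn_one (α := Ω) (μ := P) (β := ℂ), AEEqFun.coeFn_zero (α := Ω) (μ := P) (β := ℂ)]
    with ω h h1 h0
  have hη : evalMat (Matrix.diagonal fun _ => unitRV P) ω
      = (1 : Matrix (Fin N) (Fin N) ℂ) := by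
    ext i j
    by_cases hij : i = j
    · subst hij
      simp [evalMat, unitRV, h1]
    · simp [evalMat, hij, h0]
  rw [List.ofFn_eq_map, h, hη, mul_one, chiOrder, List.map_append, List.prod_append]

/-- The entries of a product of matrices are sums over walks. -/
theorem prod_ofFn_apply {R : Type*} [CommSemiring R] {n : ℕ}
    (B : Fin n → Matrix (Fin N) (Fin N) R) (a b : Fin N) :
    (List.ofFn B).prod a b = ∑ w : Fin (n + 1) → Fin N,
      if w 0 = a ∧ w (Fin.last n) = b then ∏ p, B p (w p.castSucc) (w p.succ) else 0 := by
  induction n generalizing a with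
  | zero =>
    rw [← (Equiv.funUnique (Fin 1) (Fin N)).symm.sum_comp]
    simp [Matrix.one_apply, ite_and]
  | succ n ih =>
    have h1 : (List.ofFn B).prod a b = ∑ w : Fin (n + 1) → Fin N, if w (Fin.last n) = b then
        B 0 a (w 0) * ∏ p : Fin n, B p.succ (w p.castSucc) (w p.succ) else 0 := by
      rw [List.ofFn_succ, List.prod_cons, Matrix.mul_apply]
      simp only [ih, Finset.mul_sum]
      rw [Finset.sum_comm]
      refine Finset.sum_congr rfl fun w _ => ?_
      rw [Finset.sum_eq_single (w 0)]
      · simp only [true_and, mul_ite, mul_zero]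
      · intro c _ hc
        simp [Ne.symm hc]
      · simp
    -- A walk of length `n + 1` is split into its starting point, forced to be `a`, and the
    -- remaining walk.
    rw [h1, ← (Fin.consEquiv fun _ : Fin (n + 2) => Fin N).sum_comp, Fintype.sum_prod_type]
    symm
    refine Eq.trans (Finset.sum_eq_single a (fun x _ hx => ?_)
      fun h => absurd (Finset.mem_univ a) h) ?_
    · simp [hx]
    · refine Finset.sum_congr rfl fun w _ => ?_
      simp only [true_and, Fin.consEquiv_apply, Fin.cons_zero, ← Fin.succ_last, Fin.cons_succ,
        Fin.prod_univ_succ, Fin.castSucc_zero, ← Fin.succ_castSucc]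

theorem trace_prod_ofFn {R : Type*} [CommSemiring R] {n : ℕ}
    (B : Fin n → Matrix (Fin N) (Fin N) R) :
    (List.ofFn B).prod.trace = ∑ w : Fin (n + 1) → Fin N with w 0 = w (Fin.last n),
      ∏ p, B p (w p.castSucc) (w p.succ) := by
  simp only [Matrix.trace, Matrix.diag, prod_ofFn_apply]
  rw [Finset.sum_comm, Finset.sum_filter]
  refine Finset.sum_congr rfl fun w _ => ?_
  rw [Finset.sum_eq_single (w 0)]
  · simp [eq_comm]
  · intro c _ hc
    simp [Ne.symm hc]
  · simp

/-- The expected trace of a product of left and right matrices is a sum over closed walks. -/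
theorem trace_matExpectation [IsProbabilityMeasure P]
    (X : I ⊕ J → Matrix (Fin N) (Fin N) (LInfMinus P)) {n : ℕ} (χ : Fin n → I ⊕ J)
    {σ : Fin n ≃ Fin n} (hσ : chiOrder χ = List.ofFn σ) :
    (matExpectation (unitRV P) (expect P) (List.ofFn fun t => faceOp X (χ t)).prod).trace =
      ∑ w : Fin (n + 1) → Fin N with w 0 = w (Fin.last n),
        ∫ ω, ∏ t, (X (χ t) (w (σ.symm t).castSucc) (w (σ.symm t).succ)).1 ω ∂P := by
  set η := (List.ofFn fun t => faceOp X (χ t)).prod (Matrix.diagonal fun _ => unitRV P) with hη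
  have h1 : (matExpectation (unitRV P) (expect P)
      (List.ofFn fun t => faceOp X (χ t)).prod).trace = ∑ l, ∫ ω, (η l l).1 ω ∂P := rfl
  rw [h1, ← integral_finsetSum _ fun l _ => integrable_LInfMinus (η l l),
    ← integral_finsetSum _ fun w _ => integrable_prod_LInfMinus Finset.univ fun t =>
      X (χ t) (w (σ.symm t).castSucc) (w (σ.symm t).succ)]
  refine integral_congr_ae ?_
  filter_upwards [evalMat_prod_faceOp_diagonal X χ] with ω hω
  have h2 : ∑ l, (η l l).1 ω = (evalMat η ω).trace := rfl
  rw [h2, hω, hσ, List.map_ofFn, trace_prod_ofFn]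
  refine Finset.sum_congr rfl fun w _ => ?_
  exact Fintype.prod_equiv σ _ _ fun p => by simp [evalMat]

end Operators

/-! ### Moments of bi-free central limit distributions -/

section Cumulants

variable {A : Type*} [Ring A] [Algebra ℂ A] {φ : A →ₗ[ℂ] ℂ} {I J : Type*} {a : I ⊕ J → A}

/-- Apart from the one-block partition, a partition of two points consists of singletons, whose
cumulants vanish. The length is only propositionally `2` so that the lemma applies to the
cardinality of a block. -/
theorem bifreeCumulant_two (hclt : HasBifreeCentralLimit φ a) {n : ℕ} (hn : n = 2)
    (χ : Fin n → I ⊕ J) :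
    bifreeCumulant φ n (fun t => sideOf (χ t)) (fun t => a (χ t)) =
      φ (List.ofFn fun t => a (χ t)).prod := by
  rw [bifreeCumulant, sub_eq_self]
  refine Finset.sum_eq_zero fun π _ => ?_
  have hne : (Finset.univ : Finset (Fin n)).Nonempty := ⟨⟨0, by omega⟩, Finset.mem_univ _⟩
  obtain ⟨V, hV⟩ := π.1.parts_nonempty hne.ne_empty
  refine Finset.prod_eq_zero (Finset.mem_attach _ ⟨V, hV⟩) (hclt V.card _ (Or.inl ?_))
  have h1 := (π.1.nonempty_of_mem_parts hV).card_pos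
  have h2 : V ≠ Finset.univ := fun h => (Finset.mem_filter.1 π.2).2 (h ▸ hV)
  have h3 := (Finset.card_lt_iff_ne_univ V).2 h2
  rw [Fintype.card_fin] at h3
  omega

/-- The cumulant attached to a block. -/
noncomputable def blockCumulant (φ : A →ₗ[ℂ] ℂ) (a : I ⊕ J → A) {n : ℕ} (χ : Fin n → I ⊕ J)
    (V : Finset (Fin n)) : ℂ :=
  bifreeCumulant φ V.card ((fun t => sideOf (χ t)) ∘ V.orderEmbOfFin rfl)
    ((fun t => a (χ t)) ∘ V.orderEmbOfFin rfl)

theorem blockCumulant_pair {C : Matrix (I ⊕ J) (I ⊕ J) ℝ} (hC : C.IsSymm)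
    (hclt : HasBifreeCentralLimit φ a) (hcov : ∀ k l, φ (a k * a l) = (C k l : ℂ))
    {n : ℕ} (χ : Fin n → I ⊕ J) {s t : Fin n} (hst : s ≠ t) :
    blockCumulant φ a χ {s, t} = (C (χ s) (χ t) : ℂ) := by
  wlog hlt : s < t generalizing s t
  -- The cumulant reads the block in increasing order; symmetry of `C` makes the order of `s` and
  -- `t` irrelevant.
  · rw [Finset.pair_comm, this hst.symm (lt_of_le_of_ne (not_lt.1 hlt) hst.symm), hC.apply]
  have hcard : ({s, t} : Finset (Fin n)).card = 2 := Finset.card_pair hst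
  have hofFn : ∀ (k : ℕ) (hk : k = 2) (f : Fin k → A),
      (List.ofFn f).prod = f ⟨0, by omega⟩ * f ⟨1, by omega⟩ := by
    rintro k rfl f
    simp [List.ofFn_succ]
  have key := bifreeCumulant_two hclt hcard (χ ∘ ({s, t} : Finset (Fin n)).orderEmbOfFin rfl)
  refine key.trans ?_
  rw [hofFn _ hcard, hcov]
  have h0 := ({s, t} : Finset (Fin n)).orderEmbOfFin_mem rfl ⟨0, by omega⟩
  have h1 := ({s, t} : Finset (Fin n)).orderEmbOfFin_mem rfl ⟨1, by omega⟩
  have h01 : ({s, t} : Finset (Fin n)).orderEmbOfFin rfl ⟨0, by omega⟩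
      < ({s, t} : Finset (Fin n)).orderEmbOfFin rfl ⟨1, by omega⟩ :=
    (({s, t} : Finset (Fin n)).orderEmbOfFin rfl).strictMono (by simp [Fin.lt_def])
  simp only [Function.comp_apply]
  generalize ({s, t} : Finset (Fin n)).orderEmbOfFin rfl ⟨0, by omega⟩ = x at *
  generalize ({s, t} : Finset (Fin n)).orderEmbOfFin rfl ⟨1, by omega⟩ = y at *
  simp only [Finset.mem_insert, Finset.mem_singleton] at h0 h1
  rcases h0 with rfl | rfl <;> rcases h1 with rfl | rfl
  · exact absurd h01 (lt_irrefl _)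
  · rfl
  · exact absurd h01 hlt.not_gt
  · exact absurd h01 (lt_irrefl _)

open Classical in
/-- The bi-non-crossing pair partitions. -/
noncomputable def bncPairs {n : ℕ} (χ : Fin n → Side) :
    Finset (Finpartition (Finset.univ : Finset (Fin n))) :=
  (bnc χ).filter fun π => ∀ V ∈ π.parts, V.card = 2

theorem mem_bncPairs {n : ℕ} {χ : Fin n → Side}
    {π : Finpartition (Finset.univ : Finset (Fin n))} :
    π ∈ bncPairs χ ↔ IsBiNonCrossing χ π ∧ ∀ V ∈ π.parts, V.card = 2 := by
  simp [bncPairs, bnc]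

/-- A block of size other than two has vanishing cumulant and kills its partition. The empty word is
outside the moment-cumulant relation and is settled by `φ 1 = 1` against the single empty partition.
-/
theorem moment_eq_sum_bncPairs (h1 : φ 1 = 1) (hclt : HasBifreeCentralLimit φ a) {n : ℕ}
    (χ : Fin n → I ⊕ J) :
    φ (List.ofFn fun t => a (χ t)).prod =
      ∑ π ∈ bncPairs fun t => sideOf (χ t), ∏ V ∈ π.parts, blockCumulant φ a χ V := by
  classical
  rcases Nat.eq_zero_or_pos n with rfl | hn
  · have hparts : ∀ π : Finpartition (Finset.univ : Finset (Fin 0)), π.parts = ∅ := fun π =>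
      Finset.eq_empty_of_forall_notMem fun V hV => (π.nonempty_of_mem_parts hV).elim fun x _ =>
        x.elim0
    have huniq : (bncPairs fun t => sideOf (χ t)) = {⊥} :=
      Finset.eq_singleton_iff_unique_mem.2
        ⟨mem_bncPairs.2 ⟨fun V hV => by simp [hparts] at hV, fun V hV => by simp [hparts] at hV⟩,
          fun π _ => Finpartition.ext (by rw [hparts, hparts])⟩
    rw [huniq, Finset.sum_singleton, hparts, Finset.prod_empty, List.ofFn_zero, List.prod_nil, h1]
  · rw [moment_eq_sum_bifreeCumulant φ hn (fun t => sideOf (χ t)), bncPairs, Finset.sum_filter]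
    refine Finset.sum_congr rfl fun π _ => ?_
    split_ifs with h
    · rfl
    · push Not at h
      obtain ⟨V, hV, hV2⟩ := h
      refine Finset.prod_eq_zero hV (hclt V.card (χ ∘ V.orderEmbOfFin rfl) ?_)
      have := (π.nonempty_of_mem_parts hV).card_pos
      omega

end Cumulants

/-! ### The partition of a word given by a walk -/

section EdgePartition

variable {α : Type*} {n : ℕ}

/-- Two positions are equivalent if the corresponding steps of the walk traverse the same edge. -/
noncomputable def edgePartition (σ : Fin n ≃ Fin n) (w : Fin (n + 1) → α) :
    Finpartition (Finset.univ : Finset (Fin n)) :=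
  @Finpartition.ofSetoid _ _ _ (Setoid.ker fun t => stepEdge w (σ.symm t)) (Classical.decRel _)

theorem mem_part_edgePartition {σ : Fin n ≃ Fin n} {w : Fin (n + 1) → α} {s t : Fin n} :
    s ∈ (edgePartition σ w).part t ↔ stepEdge w (σ.symm s) = stepEdge w (σ.symm t) := by
  let : DecidableRel (Setoid.ker fun t => stepEdge w (σ.symm t)).r := Classical.decRel _
  exact Iff.trans (Finpartition.mem_part_ofSetoid_iff_rel
    (s := Setoid.ker fun t => stepEdge w (σ.symm t))) eq_comm

theorem finpartition_ext_part {π ρ : Finpartition (Finset.univ : Finset (Fin n))}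
    (h : ∀ s t, s ∈ π.part t ↔ s ∈ ρ.part t) : π = ρ := by
  have hpart : ∀ t, π.part t = ρ.part t := fun t => Finset.ext fun s => h s t
  have himg : ∀ τ : Finpartition (Finset.univ : Finset (Fin n)),
      τ.parts = Finset.univ.image τ.part := by
    intro τ
    ext V
    simp only [Finset.mem_image, Finset.mem_univ, true_and]
    constructor
    · intro hV
      obtain ⟨t, ht⟩ := τ.nonempty_of_mem_parts hV
      exact ⟨t, τ.part_eq_of_mem hV ht⟩
    · rintro ⟨t, rfl⟩
      exact τ.part_mem.2 (Finset.mem_univ t)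
  refine Finpartition.ext ?_
  rw [himg, himg]
  exact Finset.image_congr fun t _ => hpart t

/-- Since `σ` carries the order of the steps to the order attached to `χ`, a non-crossing pairing of
steps becomes a bi-non-crossing pairing of positions. -/
theorem edgePartition_mem_bncPairs [DecidableEq α] {χ : Fin n → Side} {σ : Fin n ≃ Fin n}
    (hσ : ∀ s t, chiLT χ s t ↔ σ.symm s < σ.symm t) {w : Fin (n + 1) → α} (hw : EdgesRepeat w)
    (hc : 2 * (Finset.univ.image w).card = n + 2) :
    edgePartition σ w ∈ bncPairs χ ∧ ∀ s t, s ≠ t → s ∈ (edgePartition σ w).part t →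
      w (σ.symm s).castSucc = w (σ.symm t).succ ∧
        w (σ.symm s).succ = w (σ.symm t).castSucc := by
  obtain ⟨m, hne, hker, hopp, hnc⟩ := exists_pairing_of_card_image_eq hw hc
  have hpart : ∀ s t, s ∈ (edgePartition σ w).part t ↔ s = t ∨ σ.symm s = m (σ.symm t) :=
    fun s t => by rw [mem_part_edgePartition, hker, σ.symm.injective.eq_iff]
  refine ⟨mem_bncPairs.2 ⟨?_, ?_⟩, fun s t hst hs => ?_⟩
  · intro V hV W hW x hx y hy z hz u hu hxy hyz hzu
    rw [hσ] at hxy hyz hzu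
    have hz' : z ∈ (edgePartition σ w).part x := by
      rwa [(edgePartition σ w).part_eq_of_mem hV hx]
    have hu' : u ∈ (edgePartition σ w).part y := by
      rwa [(edgePartition σ w).part_eq_of_mem hW hy]
    have hz'' := ((hpart _ _).1 hz').resolve_left fun h => by
      rw [h] at hyz; exact lt_asymm hxy hyz
    have hu'' := ((hpart _ _).1 hu').resolve_left fun h => by
      rw [h] at hzu; exact lt_asymm hyz hzu
    rw [hz''] at hyz hzu
    rw [hu''] at hzu
    exact (hnc _ _ hxy hyz hzu).elim
  · intro V hV
    obtain ⟨t, ht⟩ := (edgePartition σ w).nonempty_of_mem_parts hV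
    have hVt : V = {t, σ (m (σ.symm t))} := by
      rw [← (edgePartition σ w).part_eq_of_mem hV ht]
      ext s
      rw [hpart, Equiv.symm_apply_eq]
      simp
    rw [hVt, Finset.card_pair]
    intro h
    exact hne (σ.symm t) ((Equiv.symm_apply_eq σ).2 h).symm
  · rw [((hpart _ _).1 hs).resolve_left hst]
    exact ⟨(hopp _).2.symm, (hopp _).1.symm⟩

open Classical in
/-- The number of closed walks with the maximal number of vertices that induce a given
bi-non-crossing pair partition. -/
theorem card_walks_edgePartition_eq {χ : Fin n → Side} {σ : Fin n ≃ Fin n}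
    (hσ : ∀ s t, chiLT χ s t ↔ σ.symm s < σ.symm t)
    {π : Finpartition (Finset.univ : Finset (Fin n))} (hπ : π ∈ bncPairs χ) (N : ℕ) :
    (Finset.univ.filter fun w : Fin (n + 1) → Fin N =>
      (w 0 = w (Fin.last n) ∧ EdgesRepeat w ∧ 2 * (Finset.univ.image w).card = n + 2) ∧
        edgePartition σ w = π).card = N.descFactorial (n / 2 + 1) := by
  obtain ⟨hnc, h2⟩ := mem_bncPairs.1 hπ
  have hex : ∀ t, ∃ s, s ≠ t ∧ π.part t = {t, s} := by
    intro t
    have hmem : π.part t ∈ π.parts := π.part_mem.2 (Finset.mem_univ t)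
    have ht : t ∈ π.part t := π.mem_part_self.2 (Finset.mem_univ t)
    obtain ⟨x, y, hxy, h⟩ := Finset.card_eq_two.1 (h2 _ hmem)
    rw [h] at ht ⊢
    rcases Finset.mem_insert.1 ht with rfl | ht
    · exact ⟨y, hxy.symm, rfl⟩
    · rw [Finset.mem_singleton] at ht
      subst ht
      exact ⟨x, hxy, Finset.pair_comm _ _⟩
  choose g hgne hg using hex
  have hpart : ∀ s t, s ∈ π.part t ↔ s = t ∨ s = g t := fun s t => by rw [hg]; simp
  have hgg : ∀ t, g (g t) = t := by
    intro t
    have h1 : π.part (g t) = π.part t :=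
      π.part_eq_of_mem (π.part_mem.2 (Finset.mem_univ t)) ((hpart _ _).2 (Or.inr rfl))
    have h3 : g (g t) ∈ π.part t := by rw [← h1]; exact (hpart _ _).2 (Or.inr rfl)
    exact ((hpart _ _).1 h3).resolve_right (hgne _)
  -- The partner map `g` of `π` is conjugated by `σ` into a pairing of steps, where the count for
  -- walks is available.
  have hm : IsNonCrossingPairing fun p => σ.symm (g (σ p)) := by
    refine ⟨fun p h => hgne _ ((Equiv.symm_apply_eq σ).1 h), fun p => by simp [hgg],
      fun s t h1 h3 h4 => ?_⟩
    have hVW := hnc _ (π.part_mem.2 (Finset.mem_univ (σ s))) _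
      (π.part_mem.2 (Finset.mem_univ (σ t))) (σ s) ((hpart _ _).2 (Or.inl rfl)) (σ t)
      ((hpart _ _).2 (Or.inl rfl)) (g (σ s)) ((hpart _ _).2 (Or.inr rfl)) (g (σ t))
      ((hpart _ _).2 (Or.inr rfl)) (by rw [hσ]; simpa using h1) (by rw [hσ]; simpa using h3)
      (by rw [hσ]; exact h4)
    have h5 : σ t ∈ π.part (σ s) := by rw [hVW]; exact (hpart _ _).2 (Or.inl rfl)
    rcases (hpart _ _).1 h5 with h | h
    · rw [σ.injective h] at h1
      exact lt_irrefl _ h1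
    · rw [← h, Equiv.symm_apply_apply] at h3
      exact lt_irrefl _ h3
  rw [← card_walks_of_pairing hm N]
  congr 1
  ext w
  simp only [Finset.mem_filter, Finset.mem_univ, true_and]
  refine and_congr ?_ ?_
  · convert Iff.rfl
  · constructor
    · rintro rfl p q
      have := hpart (σ q) (σ p)
      rw [mem_part_edgePartition, Equiv.symm_apply_apply, Equiv.symm_apply_apply,
        σ.injective.eq_iff] at this
      rw [this, Equiv.eq_symm_apply]
    · intro h
      refine finpartition_ext_part fun s t => ?_
      rw [mem_part_edgePartition, h, hpart, Equiv.apply_symm_apply, σ.symm.injective.eq_iff,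
        σ.symm.injective.eq_iff]

end EdgePartition

/-! ### The limit of the expected traces -/

section Limit

theorem tendsto_descFactorial_div (k : ℕ) :
    Tendsto (fun N : ℕ => (N.descFactorial k : ℂ) / (N : ℂ) ^ k) atTop (𝓝 1) := by
  have hz : ∀ᶠ N : ℕ in atTop, ((N : ℝ) ^ k) ≠ 0 :=
    eventually_atTop.2 ⟨1, fun N hN => pow_ne_zero _ (Nat.cast_ne_zero.2 (by omega))⟩
  have h := (Asymptotics.isEquivalent_iff_tendsto_one hz).1 (isEquivalent_descFactorial k)
  have h' := (Complex.continuous_ofReal.tendsto 1).comp h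
  simpa [Function.comp_def] using h'

variable {I J : Type*} {C : Matrix (I ⊕ J) (I ⊕ J) ℝ}
  {Ω : ℕ → Type*} [∀ N, MeasurableSpace (Ω N)] {P : ∀ N, Measure (Ω N)}
  {X : ∀ N : ℕ, I ⊕ J → Matrix (Fin N) (Fin N) (LInfMinus (P N))} {n : ℕ}

/-- The contribution of a walk to the expected trace. -/
noncomputable def walkExpectation (X : ∀ N : ℕ, I ⊕ J → Matrix (Fin N) (Fin N) (LInfMinus (P N)))
    (χ : Fin n → I ⊕ J) (σ : Fin n ≃ Fin n) {N : ℕ} (w : Fin (n + 1) → Fin N) : ℂ :=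
  ∫ ω, ∏ t, (X N (χ t) (w (σ.symm t).castSucc) (w (σ.symm t).succ)).1 ω ∂(P N)

theorem walkExpectation_eq_zero (hX : IsRandomTwoFaced C P X) (χ : Fin n → I ⊕ J)
    (σ : Fin n ≃ Fin n) {N : ℕ} {w : Fin (n + 1) → Fin N} (hw : ¬ EdgesRepeat w) :
    walkExpectation X χ σ w = 0 := by
  simp only [EdgesRepeat, not_forall, not_exists, not_and] at hw
  obtain ⟨p, hp⟩ := hw
  refine integral_prod_eq_zero χ hX (fun t => (w (σ.symm t).castSucc, w (σ.symm t).succ))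
    ⟨σ p, fun t ht => ?_⟩
  by_contra hne
  refine hp (σ.symm t) (fun h => hne ((Equiv.symm_apply_eq σ).1 h)) ?_
  simpa [stepEdge] using ht

/-- The walks that do not visit the maximal number of vertices are negligible. -/
theorem tendsto_sum_walkExpectation_zero [∀ N, IsProbabilityMeasure (P N)]
    (hX : IsRandomTwoFaced C P X) (χ : Fin n → I ⊕ J) (σ : Fin n ≃ Fin n)
    (S : ∀ N, Finset (Fin (n + 1) → Fin N))
    (hS : ∀ N, ∀ w ∈ S N, EdgesRepeat w → 2 * (Finset.univ.image w).card ≠ n + 2) :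
    Tendsto (fun N : ℕ => (1 / (N : ℂ)) * ∑ w ∈ S N, walkExpectation X χ σ w) atTop (𝓝 0) := by
  classical
  obtain ⟨A, hA, N₀, hbd⟩ := exists_norm_integral_prod_le χ hX
  -- The largest number of vertices `v` allowed by `2 * v ≤ n + 2` and `2 * v ≠ n + 2`.
  set k := (n + 1) / 2 with hk
  have hlim : Tendsto (fun N : ℕ => ((k : ℝ) ^ (n + 1) * A ^ n) * (N : ℝ) ^ (-(1 / 2) : ℝ))
      atTop (𝓝 0) := by
    have := ((tendsto_rpow_neg_atTop (y := 1 / 2) (by norm_num)).comp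
      tendsto_natCast_atTop_atTop).const_mul ((k : ℝ) ^ (n + 1) * A ^ n)
    simpa using this
  refine squeeze_zero_norm' ?_ hlim
  filter_upwards [eventually_gt_atTop N₀, eventually_ge_atTop 1] with N hN hN1
  have hNpos : (0 : ℝ) < N := by exact_mod_cast hN1
  have hNone : (1 : ℝ) ≤ N := by exact_mod_cast hN1
  set T := Finset.univ.filter fun w : Fin (n + 1) → Fin N => (Finset.univ.image w).card ≤ k
  have hcard : (T.card : ℝ) ≤ (k : ℝ) ^ (n + 1) * (N : ℝ) ^ k := by
    have := card_filter_card_image_le (ι := Fin (n + 1)) (β := Fin N) k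
    rw [Fintype.card_fin, Fintype.card_fin] at this
    exact_mod_cast this
  set b := (A * (N : ℝ) ^ (-(1 / 2) : ℝ)) ^ n
  have hb0 : 0 ≤ b := by positivity
  have hsum : ‖∑ w ∈ S N, walkExpectation X χ σ w‖ ≤ T.card * b := by
    have h1 : ∑ w ∈ S N, walkExpectation X χ σ w
        = ∑ w ∈ (S N).filter EdgesRepeat, walkExpectation X χ σ w :=
      (Finset.sum_filter_of_ne fun w _ hw => by
        by_contra h
        exact hw (walkExpectation_eq_zero hX χ σ h)).symm
    have h2 : (S N).filter EdgesRepeat ⊆ T := by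
      intro w hw
      obtain ⟨hwS, hwr⟩ := Finset.mem_filter.1 hw
      have h3 := (card_image_le_of_edgesRepeat hwr).1
      have h4 := hS N w hwS hwr
      exact Finset.mem_filter.2 ⟨Finset.mem_univ _, by omega⟩
    have h3 : ∀ w ∈ (S N).filter EdgesRepeat, ‖walkExpectation X χ σ w‖ ≤ b := fun w _ =>
      hbd N hN fun t => (w (σ.symm t).castSucc, w (σ.symm t).succ)
    rw [h1]
    refine (norm_sum_le_of_le _ h3).trans ?_
    rw [Finset.sum_const, nsmul_eq_mul]
    exact mul_le_mul_of_nonneg_right (by exact_mod_cast Finset.card_le_card h2) hb0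
  -- The exponent is `-1 + k - n / 2`, at most `-1 / 2` because `2 * k ≤ n + 1`.
  have hpow : (N : ℝ)⁻¹ * ((N : ℝ) ^ k * ((N : ℝ) ^ (-(1 / 2) : ℝ)) ^ n)
      ≤ (N : ℝ) ^ (-(1 / 2) : ℝ) := by
    rw [← Real.rpow_natCast, ← Real.rpow_natCast ((N : ℝ) ^ (-(1 / 2) : ℝ)),
      ← Real.rpow_mul hNpos.le, ← Real.rpow_neg_one, ← Real.rpow_add hNpos,
      ← Real.rpow_add hNpos]
    refine Real.rpow_le_rpow_of_exponent_le hNone ?_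
    have : (2 * k : ℝ) ≤ n + 1 := by
      have : 2 * k ≤ n + 1 := by omega
      exact_mod_cast this
    linarith
  rw [norm_mul, norm_div, norm_one, Complex.norm_natCast, one_div]
  calc (N : ℝ)⁻¹ * ‖∑ w ∈ S N, walkExpectation X χ σ w‖
      ≤ (N : ℝ)⁻¹ * (((k : ℝ) ^ (n + 1) * (N : ℝ) ^ k) * b) := by
        refine mul_le_mul_of_nonneg_left (hsum.trans ?_) (by positivity)
        exact mul_le_mul_of_nonneg_right hcard hb0
    _ = ((k : ℝ) ^ (n + 1) * A ^ n) *
          ((N : ℝ)⁻¹ * ((N : ℝ) ^ k * ((N : ℝ) ^ (-(1 / 2) : ℝ)) ^ n)) := by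
        simp only [b, mul_pow]; ring
    _ ≤ _ := mul_le_mul_of_nonneg_left hpow (by positivity)

open Classical in
/-- The closed walks with repeated edges that visit the maximal number of vertices. -/
noncomputable def treeWalks (n N : ℕ) : Finset (Fin (n + 1) → Fin N) :=
  Finset.univ.filter fun w =>
    w 0 = w (Fin.last n) ∧ EdgesRepeat w ∧ 2 * (Finset.univ.image w).card = n + 2

/-- The contribution of the walks that visit the maximal number of vertices. -/
theorem sum_treeWalks [∀ N, IsProbabilityMeasure (P N)] (hX : IsRandomTwoFaced C P X)
    (χ : Fin n → I ⊕ J) {σ : Fin n ≃ Fin n}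
    (hσ : ∀ s t, chiLT (fun t => sideOf (χ t)) s t ↔ σ.symm s < σ.symm t)
    (κ : Finset (Fin n) → ℂ) (hκ : ∀ s t, s ≠ t → κ {s, t} = (C (χ s) (χ t) : ℂ)) (N : ℕ) :
    ∑ w ∈ treeWalks n N, walkExpectation X χ σ w =
      ∑ π ∈ bncPairs fun t => sideOf (χ t),
        (N.descFactorial (n / 2 + 1) : ℂ) * ∏ V ∈ π.parts, κ V / N := by
  classical
  have hmem : ∀ w ∈ treeWalks n N, EdgesRepeat w ∧ 2 * (Finset.univ.image w).card = n + 2 := by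
    intro w hw
    have := (Finset.mem_filter.1 hw).2.2
    refine ⟨this.1, ?_⟩
    convert this.2
  rw [← Finset.sum_fiberwise_of_maps_to (g := edgePartition σ) fun w hw =>
    (edgePartition_mem_bncPairs hσ (hmem w hw).1 (hmem w hw).2).1]
  refine Finset.sum_congr rfl fun π hπ => ?_
  have hconst : ∀ w ∈ (treeWalks n N).filter fun w => edgePartition σ w = π,
      walkExpectation X χ σ w = ∏ V ∈ π.parts, κ V / N := by
    intro w hw
    obtain ⟨hw', rfl⟩ := Finset.mem_filter.1 hw
    obtain ⟨h1, h2⟩ := hmem w hw'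
    refine integral_prod_eq_prod_covariance χ hX
      (fun t => (w (σ.symm t).castSucc, w (σ.symm t).succ)) _ (fun s t => mem_part_edgePartition)
      (mem_bncPairs.1 hπ).2 (fun s t hst hs => ?_) κ hκ
    have := (edgePartition_mem_bncPairs hσ h1 h2).2 s t hst hs
    exact Prod.ext this.1 this.2
  rw [Finset.sum_congr rfl hconst, Finset.sum_const, nsmul_eq_mul]
  congr 2
  rw [← card_walks_edgePartition_eq hσ hπ N, treeWalks, Finset.filter_filter]

theorem tendsto_sum_treeWalks [∀ N, IsProbabilityMeasure (P N)] (hX : IsRandomTwoFaced C P X)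
    (χ : Fin n → I ⊕ J) {σ : Fin n ≃ Fin n}
    (hσ : ∀ s t, chiLT (fun t => sideOf (χ t)) s t ↔ σ.symm s < σ.symm t)
    (κ : Finset (Fin n) → ℂ) (hκ : ∀ s t, s ≠ t → κ {s, t} = (C (χ s) (χ t) : ℂ)) :
    Tendsto (fun N : ℕ => (1 / (N : ℂ)) * ∑ w ∈ treeWalks n N, walkExpectation X χ σ w) atTop
      (𝓝 (∑ π ∈ bncPairs fun t => sideOf (χ t), ∏ V ∈ π.parts, κ V)) := by
  simp only [sum_treeWalks hX χ hσ κ hκ, Finset.mul_sum]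
  refine tendsto_finsetSum _ fun π hπ => ?_
  have hcard : π.parts.card = n / 2 := by
    have h1 := π.sum_card_parts
    rw [Finset.sum_congr rfl (mem_bncPairs.1 hπ).2, Finset.sum_const, smul_eq_mul,
      Finset.card_univ, Fintype.card_fin] at h1
    omega
  have h := (tendsto_descFactorial_div (n / 2 + 1)).mul_const (∏ V ∈ π.parts, κ V)
  rw [one_mul] at h
  -- The `n / 2` blocks give `N ^ (n / 2)` in the denominator and the normalized trace gives one
  -- more factor, matching the `n / 2 + 1` free labels.
  refine h.congr fun N => ?_
  rw [Finset.prod_div_distrib, Finset.prod_const, hcard, pow_succ]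
  simp only [div_eq_mul_inv, mul_inv, one_mul]
  ring

end Limit

end BiFree

/-! ### The limit theorem for random two-faced families -/

theorem theorem2p2 {I J : Type*}
    (C : Matrix (I ⊕ J) (I ⊕ J) ℝ) (hC : C.PosSemidef)
    {A : Type*} [Ring A] [StarRing A] [Algebra ℂ A] [StarModule ℂ A]
    (φ : A →ₗ[ℂ] ℂ) (hφ : BiFree.IsStarProbabilitySpace φ)
    (a : I ⊕ J → A) (ha : ∀ k, IsSelfAdjoint (a k))
    (hclt : BiFree.HasBifreeCentralLimit φ a)
    (hcov : ∀ k l, φ (a k * a l) = (C k l : ℂ))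
    {Ω : ℕ → Type*} [∀ N, MeasurableSpace (Ω N)]
    (P : ∀ N, Measure (Ω N)) [∀ N, IsProbabilityMeasure (P N)]
    (X : ∀ N : ℕ, I ⊕ J → Matrix (Fin N) (Fin N) (BiFree.LInfMinus (P N)))
    (hX : BiFree.IsRandomTwoFaced C P X)
    (n : ℕ) (χ : Fin n → I ⊕ J) :
    Tendsto
      (fun N : ℕ => (1 / (N : ℂ)) *
        (BiFree.matExpectation (BiFree.unitRV (P N)) (BiFree.expect (P N))
          (List.ofFn fun t => BiFree.faceOp (X N) (χ t)).prod).trace)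
      atTop (𝓝 (φ (List.ofFn fun t => a (χ t)).prod)) := by
  classical
  obtain ⟨σ, hσ, hlt⟩ := BiFree.exists_chiOrder_equiv χ
  have hsymm : C.IsSymm := by
    have := hC.isHermitian
    rwa [Matrix.IsHermitian, Matrix.conjTranspose_eq_transpose_of_trivial] at this
  rw [BiFree.moment_eq_sum_bncPairs hφ.map_one hclt χ]
  have hmain := BiFree.tendsto_sum_treeWalks hX χ hlt (BiFree.blockCumulant φ a χ) fun s t hst =>
    BiFree.blockCumulant_pair hsymm hclt hcov χ hst
  -- The error term collects all closed walks outside `treeWalks`; one that repeats its edges and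
  -- has the maximal number of vertices would belong to `treeWalks`.
  have hrest := BiFree.tendsto_sum_walkExpectation_zero hX χ σ
    (fun N => (Finset.univ.filter fun w : Fin (n + 1) → Fin N => w 0 = w (Fin.last n)).filter
      fun w => w ∉ BiFree.treeWalks n N) fun N w hw hr hc => by
        obtain ⟨h1, h2⟩ := Finset.mem_filter.1 hw
        refine h2 (Finset.mem_filter.2
          ⟨Finset.mem_univ _, (Finset.mem_filter.1 h1).2, hr, ?_⟩)
        convert hc
  have hsum := hmain.add hrest
  rw [add_zero] at hsum
  refine hsum.congr fun N => ?_
  rw [BiFree.trace_matExpectation (X N) χ hσ, ← mul_add]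
  congr 1
  rw [← Finset.sum_filter_add_sum_filter_not
    (Finset.univ.filter fun w : Fin (n + 1) → Fin N => w 0 = w (Fin.last n))
    (fun w => w ∈ BiFree.treeWalks n N)]
  congr 1
  refine Finset.sum_congr ?_ fun _ _ => rfl
  ext w
  simp only [Finset.mem_filter, Finset.mem_univ, true_and]
  exact ⟨fun h => ⟨(Finset.mem_filter.1 h).2.1, h⟩, fun h => h.2⟩
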